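/- **Setting.** For $d\ge 1$, a target on $\mathbb R^d$ is a probability density $\pi = e^{-V}/\int e^{-V}$ with $V\in C^2(\mathbb R^d)$, $\int e^{-V}<\infty$ and $\|\nabla V(x)-\nabla V(y)\|\le\|x-y\|$ for all $x,y$ (a $1$-log-smooth distribution). For a probability measure $\mu$, $\mathrm{FI}(\mu\,\|\,\pi)=\mathbb E_\mu\bigl[\|\nabla\ln\frac{d\mu}{d\pi}\|^2\bigr]$ (with the weak gradient of $d\mu/d\pi$; $+\infty$ if $d\mu/d\pi$ does not exist or is not weakly differentiable). An algorithm has access to an initialization oracle, which gives a probability measure $\mu_0$ (also denoting its density) with $$\max\Bigl\{\sup\ln\frac{\mu_0}{\pi},\ \sup\ln\frac{\pi}{\mu_0}\Bigr\}\le M_0 ,$$ in the sense that independent samples from $\mu_0$ and values of its density are free, and to a local oracle, which at a query point $x$ returns $V(x)$ (the potential is known only up to an additive constant) and $\nabla V(x)$; only calls to the local oracle are counted. Algorithms may be randomized and adaptive. Let $\mathscr C_\infty(d,M_0,\varepsilon)$ be the least $n$ for which some algorithm makes at most $n$ local queries and outputs a sample from a measure $\mu$ with $\sqrt{\mathrm{FI}(\mu\,\|\,\pi)}\le\varepsilon$,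 for every $1$-log-smooth target $\pi$ on $\mathbb R^d$ and every $\mu_0$ as above. **Rejection sampling with $N$ trials, followed by the heat flow for time $t$.** Query $V(0)$. In each of $N$ trials draw $X\sim\mu_0$, query $V(X)$, and accept $X$ with probability $e^{V(0)-V(X)}\big/\bigl(e^{2M_0}\mu_0(X)/\mu_0(0)\bigr)$, stopping at the first acceptance. If nothing is accepted, take a fresh sample from $\mu_0$ instead. Add an independent $\mathcal N(0,tI_d)$ vector to the resulting point and output the sum. **Proposition.** $\mathscr C_\infty(d,M_0,\varepsilon)\le\widetilde{\mathcal O}\bigl(\exp(3M_0)\log\frac{\sqrt d}{\varepsilon}\bigr)$, and the bound is attained by rejection sampling followed by a short heat flow. Precisely: there are universal constants $C>0$ and $k\in\mathbb N$ such that for all $d\ge1$, $M_0\ge0$ and $\varepsilon>0$, with $$X=\exp(3M_0)\,\max\Bigl\{1,\log\frac{\sqrt d}{\varepsilon}\Bigr\},$$ there are $N\in\mathbb N$ and $0<t\le\varepsilon^2/d$ such that $N+1\le C\,X\,(1+\log X)^k$ and, for every $1$-log-smooth $\pi$ and every $\mu_0$ as above, the algorithm just described makes at most $N+1$ local queries and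 outputs a sample from a measure $\mu$ with $\sqrt{\mathrm{FI}(\mu\,\|\,\pi)}\le\varepsilon$; in addition, $\mathscr C_\infty(d,M_0,\varepsilon)\le C\,X\,(1+\log X)^k$. -/

import Mathlib

open MeasureTheory ProbabilityTheory
open scoped ENNReal ContDiff

noncomputable section

namespace FisherSampling

/-- The Euclidean space `ℝ^d`. -/
abbrev E (d : ℕ) : Type := EuclideanSpace ℝ (Fin d)

/-! ### Target distributions -/

/-- `V` is the potential of a `β`-log-smooth probability distribution: it is twice continuously
differentiable, its gradient is `β`-Lipschitz, and `exp (-V)` can be normalized. -/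
structure IsLogSmoothPotential {d : ℕ} (β : ℝ) (V : E d → ℝ) : Prop where
  contDiff : ContDiff ℝ 2 V
  gradient_lipschitz : ∀ x y : E d, ‖gradient V x - gradient V y‖ ≤ β * ‖x - y‖
  integrable_exp_neg : Integrable (fun x => Real.exp (-V x)) volume

/-- The density of the target `π ∝ exp (-V)`. It does not change if a constant is added to `V`. -/
def targetDensity {d : ℕ} (V : E d → ℝ) (x : E d) : ℝ :=
  Real.exp (-V x) / ∫ y, Real.exp (-V y)

/-- The measure on `ℝ^d` with Lebesgue density `f`. -/
def ofDensity {d : ℕ} (f : E d → ℝ) : Measure (E d) :=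
  volume.withDensity fun x => ENNReal.ofReal (f x)

/-- The target distribution `π ∝ exp (-V)`. -/
def target {d : ℕ} (V : E d → ℝ) : Measure (E d) := ofDensity (targetDensity V)

/-! ### Relative Fisher information -/

/-- `g` is a weak gradient of `f` on `ℝ^d`. -/
structure HasWeakGradient {d : ℕ} (f : E d → ℝ) (g : E d → E d) : Prop where
  locallyIntegrable : LocallyIntegrable f volume
  locallyIntegrable_gradient : LocallyIntegrable g volume
  integral_eq : ∀ φ : E d → ℝ, ContDiff ℝ ∞ φ → HasCompactSupport φ →
    ∫ x, f x • gradient φ x = -∫ x, φ x • g x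

/-- The relative Fisher information `FI(μ ‖ π) = 𝔼_μ ‖∇ ln (dμ/dπ)‖²`, where
`∇ ln (dμ/dπ) = ∇(dμ/dπ) / (dμ/dπ)` for the weak gradient of the density `dμ/dπ`. It is `∞` if
`μ` has no weakly differentiable density with respect to `π`. (When `π` has a positive continuous
Lebesgue density, `f` and `g` are unique almost everywhere, so that the infimum runs over copies
of one value.) -/
def fisherInfo {d : ℕ} (μ π : Measure (E d)) : ℝ≥0∞ :=
  ⨅ (f : E d → ℝ) (g : E d → E d)
    (_ : Measurable f ∧ (∀ x, 0 ≤ f x) ∧ μ = π.withDensity (fun x => ENNReal.ofReal (f x)) ∧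
      HasWeakGradient f g),
    ∫⁻ x, ‖(f x)⁻¹ • g x‖ₑ ^ 2 ∂μ

/-! ### Oracles and algorithms -/

/-- `f₀` is the density of a probability measure `μ₀`, a valid answer of the strong
initialization oracle for the target with potential `V`:
`max {sup ln (μ₀/π), sup ln (π/μ₀)} ≤ M₀`. -/
structure IsValidInit {d : ℕ} (M₀ : ℝ) (V f₀ : E d → ℝ) : Prop where
  measurable : Measurable f₀
  pos : ∀ x, 0 < f₀ x
  isProbabilityMeasure : IsProbabilityMeasure (ofDensity f₀)
  log_init_div_target_le : ∀ x, Real.log (f₀ x / targetDensity V x) ≤ M₀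
  log_target_div_init_le : ∀ x, Real.log (targetDensity V x / f₀ x) ≤ M₀

/-- A randomized, adaptive sampling algorithm in the oracle model on `ℝ^d`.

It runs for `steps` steps on a memory of type `State`. At step `k` it receives a fresh internal
random seed and a fresh sample from `μ₀` (both free). From `(memory, seed, sample)` it computes a
point `y`, receives the value of the density of `μ₀` at `y` (free), and decides whether to
query the local oracle at `y`. If it does not, the memory is updated with `updateFree`; if it
does, it pays for one query, receives `(V y, ∇V y)`, and the memory is updated with
`updateLocal`. After the last step it outputs a point computed from its memory. -/
structure SamplingAlgorithm (d : ℕ) where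
  Seed : Type
  State : Type
  [seedSpace : MeasurableSpace Seed]
  [stateSpace : MeasurableSpace State]
  seedLaw : Measure Seed
  isProbabilityMeasure_seedLaw : IsProbabilityMeasure seedLaw
  steps : ℕ
  start : State
  point : ℕ → State × Seed × E d → E d
  asksLocal : ℕ → State × Seed × E d → Bool
  updateFree : ℕ → (State × Seed × E d) × ℝ → State
  updateLocal : ℕ → (State × Seed × E d) × ℝ × ℝ × E d → State
  output : State → E d
  measurable_point : ∀ k, Measurable (point k)
  measurable_asksLocal : ∀ k, Measurable (asksLocal k)
  measurable_updateFree : ∀ k, Measurable (updateFree k)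
  measurable_updateLocal : ∀ k, Measurable (updateLocal k)
  measurable_output : Measurable output

namespace SamplingAlgorithm

variable {d : ℕ}

attribute [instance] SamplingAlgorithm.seedSpace SamplingAlgorithm.stateSpace
  SamplingAlgorithm.isProbabilityMeasure_seedLaw

/-- One step of the algorithm, for the target potential `V` and the initial density `f₀`. A
configuration is the memory together with the number of local queries made so far. -/
def step (A : SamplingAlgorithm d) (V f₀ : E d → ℝ) (k : ℕ)
    (c : (A.State × ℕ) × (A.Seed × E d)) : A.State × ℕ :=
  let z : A.State × A.Seed × E d := (c.1.1, c.2)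
  let y : E d := A.point k z
  if A.asksLocal k z = true then
    (A.updateLocal k (z, f₀ y, V y, gradient V y), c.1.2 + 1)
  else
    (A.updateFree k (z, f₀ y), c.1.2)

/-- The law of the configuration after `k` steps. The seed and the sample from `μ₀` used in each
step are independent of each other and of the past. -/
def configLaw (A : SamplingAlgorithm d) (V f₀ : E d → ℝ) : ℕ → Measure (A.State × ℕ)
  | 0 => Measure.dirac (A.start, 0)
  | k + 1 => ((A.configLaw V f₀ k).prod (A.seedLaw.prod (ofDensity f₀))).map (A.step V f₀ k)

/-- The law of the output of the algorithm. -/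
def outputLaw (A : SamplingAlgorithm d) (V f₀ : E d → ℝ) : Measure (E d) :=
  (A.configLaw V f₀ A.steps).map fun c => A.output c.1

/-- For every `1`-log-smooth target `π` and every valid initialization with parameter `M₀`, the
algorithm makes at most `n` local queries (almost surely) and outputs a sample from a measure `μ`
with `√FI(μ ‖ π) ≤ ε`. -/
def Achieves (A : SamplingAlgorithm d) (M₀ ε : ℝ) (n : ℕ) : Prop :=
  ∀ V f₀ : E d → ℝ, IsLogSmoothPotential 1 V → IsValidInit M₀ V f₀ →
    (∀ᵐ c ∂(A.configLaw V f₀ A.steps), c.2 ≤ n) ∧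
      fisherInfo (A.outputLaw V f₀) (target V) ^ (1 / 2 : ℝ) ≤ ENNReal.ofReal ε

end SamplingAlgorithm

/-- The query complexity `𝒞_∞(d, M₀, ε)`: the least number of local queries with which some
algorithm achieves `√FI(μ ‖ π) ≤ ε` over the class of `1`-log-smooth targets on `ℝ^d` with the
strong initialization oracle (`⊤` if there is no such number). -/
def queryComplexity (d : ℕ) (M₀ ε : ℝ) : ℕ∞ :=
  ⨅ (n : ℕ) (_ : ∃ A : SamplingAlgorithm d, A.Achieves M₀ ε n), (n : ℕ∞)

/-- Rejection sampling followed by the heat flow for time `t`.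

Step `0` queries the point `0`, so that `(V 0, f₀ 0)` is known from then on. In each of the steps
`1, …, N`, unless some sample has already been accepted, the sample `x` drawn from `μ₀` is queried
and is accepted with probability `π̃ x / (Z f₀ x)`, where `π̃ x = exp (V 0 - V x)` and
`Z = exp (2 M₀) / f₀ 0`. The last step replaces the accepted point (or, if all `N` trials were
rejected, a fresh sample from `μ₀`) by its sum with a centred Gaussian of covariance `t I`.

The memory is `((V 0, f₀ 0), whether a sample was accepted, current point)`, and a seed is a pair
of a uniform variable on `[0, 1]` and a standard Gaussian vector. -/
def rejectionSampler (d : ℕ) (M₀ : ℝ) (N : ℕ) (t : ℝ) : SamplingAlgorithm d where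
  Seed := unitInterval × E d
  State := (ℝ × ℝ) × Bool × E d
  seedLaw := (volume : Measure unitInterval).prod (stdGaussian (E d))
  isProbabilityMeasure_seedLaw := inferInstance
  steps := N + 2
  start := ((0, 0), false, 0)
  point k z := if k = 0 then 0 else z.2.2
  asksLocal k z := decide (k = 0) || (decide (k ≤ N) && !z.1.2.1)
  updateFree k w :=
    if k = N + 1 then
      (w.1.1.1, w.1.1.2.1,
        (if w.1.1.2.1 = true then w.1.1.2.2 else w.1.2.2) + √t • w.1.2.1.2)
    else w.1.1
  updateLocal k w :=
    if k = 0 then ((w.2.2.1, w.2.1), false, 0)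
    else if (w.1.2.1.1 : ℝ) * (Real.exp (2 * M₀) / w.1.1.1.2 * w.2.1) ≤
        Real.exp (w.1.1.1.1 - w.2.2.1) then
      (w.1.1.1, true, w.1.2.2)
    else w.1.1
  output s := s.2.2
  measurable_point k := by
    by_cases h : k = 0 <;> simp only [h, if_true, if_false] <;> fun_prop
  measurable_asksLocal k := by
    have h : Measurable fun b : Bool => decide (k = 0) || (decide (k ≤ N) && !b) :=
      measurable_of_finite _
    exact h.comp (by fun_prop : Measurable fun z :
      ((ℝ × ℝ) × Bool × E d) × (unitInterval × E d) × E d => z.1.2.1)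
  measurable_updateFree k := by
    by_cases h : k = N + 1
    · simp only [h, if_true]
      refine Measurable.prodMk (by fun_prop) (Measurable.prodMk (by fun_prop) ?_)
      refine Measurable.add (Measurable.ite ?_ (by fun_prop) (by fun_prop)) (by fun_prop)
      exact measurableSet_eq_fun (by fun_prop) measurable_const
    · simp only [h, if_false]
      fun_prop
  measurable_updateLocal k := by
    by_cases h : k = 0
    · simp only [h, if_true]
      fun_prop
    · simp only [h, if_false]
      refine Measurable.ite (measurableSet_le ?_ (by fun_prop)) (by fun_prop) (by fun_prop)
      have hu : Measurable fun w : (((ℝ × ℝ) × Bool × E d) × (unitInterval × E d) × E d) ×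
          ℝ × ℝ × E d => (w.1.2.1.1 : ℝ) := measurable_subtype_coe.comp (by fun_prop)
      fun_prop
  measurable_output := by fun_prop

end FisherSampling

end

/-! An accepted proposal has law exactly π. If one trial accepts with probability a, all N trials
fail with probability δ = (1 - a)^N, so the point before smoothing has law (1 - δ)π + δμ₀, and the
output has density Q = (1 - δ)π_t + δ(μ₀)_t, the subscript denoting the heat flow
(`outputLaw_rejectionSampler`).

The Fisher information is ∫ ‖∇Q + Q∇V‖² / Q, and (v, r) ↦ ‖v‖² / r is jointly convex, so the two
components are estimated separately (`fisherInfo_heatFlow_mixture_le`). For π_t, integration by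
parts makes the numerator an average of ∇V(y) - ∇V(x); the Lipschitz bound and Cauchy–Schwarz leave
the mean square displacement td. For (μ₀)_t there is no smoothness to use: the derivative stays on
the kernel, and ∇V is controlled through μ₀ ≤ e^{M₀} π. This costs e^{M₀} times a polynomial in d
and 1/t (`enorm_heatFlowGradient_add_smul_sq_le_of_le`).

The second cost is multiplied by δ, which decays exponentially in N. Since a ≥ e^{-3M₀}
(`le_acceptProb`), e^{3M₀} times a logarithm of that cost is enough trials, while t of order ε²/d
makes the first component small. -/

noncomputable section

namespace FisherSampling

variable {d : ℕ}

/-! ### The heat kernel -/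

/-- The density of the centred Gaussian with covariance `t I`. -/
def heatKernel (t : ℝ) (z : E d) : ℝ :=
  ((Real.pi / (1 / (2 * t))) ^ (d / 2 : ℝ))⁻¹ * Real.exp (-(1 / (2 * t)) * ‖z‖ ^ 2)

theorem heatKernel_pos {t : ℝ} (ht : 0 < t) (z : E d) : 0 < heatKernel t z := by
  unfold heatKernel; positivity

theorem continuous_heatKernel (t : ℝ) : Continuous (heatKernel t : E d → ℝ) := by
  unfold heatKernel; fun_prop

theorem hasFDerivAt_heatKernel {t : ℝ} (ht : 0 < t) (z : E d) :
    HasFDerivAt (heatKernel t) (innerSL ℝ ((-(heatKernel t z / t)) • z)) z := by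
  have h1 : HasFDerivAt (fun z : E d => ‖z‖ ^ 2) (2 • innerSL ℝ z) z :=
    (hasStrictFDerivAt_norm_sq z).hasFDerivAt
  have h2 := ((h1.const_mul (-(1 / (2 * t)))).exp).const_mul
    ((Real.pi / (1 / (2 * t))) ^ (d / 2 : ℝ))⁻¹
  refine h2.congr_fderiv ?_
  ext v
  simp only [heatKernel, map_smul, _root_.smul_apply, innerSL_apply_apply,
    smul_eq_mul, nsmul_eq_mul]
  field_simp
  simp

/-- The factor 1 + ‖z‖ makes this one bound dominate the kernel, its gradient, and its product with
any field of linear growth. -/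
theorem exists_heatKernel_bound {t : ℝ} (ht : 0 < t) :
    ∃ K : ℝ, ∀ z : E d, (1 + ‖z‖) * heatKernel t z ≤ K := by
  refine ⟨((Real.pi / (1 / (2 * t))) ^ (d / 2 : ℝ))⁻¹ * (2 + 2 * t), fun z => ?_⟩
  unfold heatKernel
  rw [mul_left_comm]
  gcongr
  rw [neg_mul, Real.exp_neg, mul_inv_le_iff₀ (Real.exp_pos _)]
  have h1 := Real.add_one_le_exp (1 / (2 * t) * ‖z‖ ^ 2)
  calc 1 + ‖z‖ ≤ 2 + ‖z‖ ^ 2 := by nlinarith [sq_nonneg (‖z‖ - 1)]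
    _ ≤ (2 + 2 * t) * (1 / (2 * t) * ‖z‖ ^ 2 + 1) := by
      have : (2 + 2 * t) * (1 / (2 * t) * ‖z‖ ^ 2 + 1)
        = 2 + ‖z‖ ^ 2 + (2 * t + ‖z‖ ^ 2 / t) := by field_simp; ring
      rw [this]
      have : 0 ≤ 2 * t + ‖z‖ ^ 2 / t := by positivity
      linarith
    _ ≤ _ := by gcongr

theorem integral_ofDensity {F : Type*} [NormedAddCommGroup F] [NormedSpace ℝ F] {f : E d → ℝ}
    (hf : Measurable f) (hf0 : ∀ x, 0 ≤ f x) (h : E d → F) :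
    ∫ x, h x ∂(ofDensity f) = ∫ x, f x • h x := by
  rw [ofDensity, integral_withDensity_eq_integral_toReal_smul (by fun_prop) (by simp)]
  simp [ENNReal.toReal_ofReal, hf0]

theorem lintegral_ofDensity {f : E d → ℝ} (hf : Measurable f) {h : E d → ℝ≥0∞}
    (hh : Measurable h) :
    ∫⁻ x, h x ∂(ofDensity f) = ∫⁻ x, ENNReal.ofReal (f x) * h x := by
  rw [ofDensity, lintegral_withDensity_eq_lintegral_mul _ (by fun_prop) hh]
  rfl

theorem integral_heatKernel {t : ℝ} (ht : 0 < t) : ∫ z : E d, heatKernel t z = 1 := by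
  unfold heatKernel
  rw [integral_const_mul, GaussianFourier.integral_rexp_neg_mul_sq_norm (by positivity)]
  simp only [finrank_euclideanSpace, Fintype.card_fin]
  exact inv_mul_cancel₀ (by positivity)

theorem integrable_heatKernel {t : ℝ} (ht : 0 < t) : Integrable (heatKernel t : E d → ℝ) := by
  -- A nonintegrable function has Bochner integral 0, not 1.
  by_contra h
  simpa [integral_undef h] using integral_heatKernel (d := d) ht

theorem lintegral_heatKernel {t : ℝ} (ht : 0 < t) :
    ∫⁻ z : E d, ENNReal.ofReal (heatKernel t z) = 1 := by
  rw [← ofReal_integral_eq_lintegral_ofReal (integrable_heatKernel ht)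
    (.of_forall fun z => (heatKernel_pos ht z).le), integral_heatKernel ht, ENNReal.ofReal_one]

theorem isProbabilityMeasure_heatKernel {t : ℝ} (ht : 0 < t) :
    IsProbabilityMeasure (ofDensity (heatKernel t : E d → ℝ)) :=
  ⟨by simpa [ofDensity] using lintegral_heatKernel ht⟩

theorem charFun_heatKernel {t : ℝ} (ht : 0 < t) (ξ : E d) :
    charFun (ofDensity (heatKernel t)) ξ = Complex.exp (-(t * ‖ξ‖ ^ 2 / 2)) := by
  rw [charFun_apply, integral_ofDensity (continuous_heatKernel t).measurable
    fun x => (heatKernel_pos ht x).le]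
  have h := GaussianFourier.integral_cexp_neg_mul_sq_norm_add
    (b := ((1 / (2 * t) : ℝ) : ℂ)) (by rw [Complex.ofReal_re]; positivity) Complex.I ξ
  have hc : (((Real.pi / (1 / (2 * t))) ^ (d / 2 : ℝ) : ℝ) : ℂ)
      = ((Real.pi : ℂ) / ((1 / (2 * t) : ℝ) : ℂ)) ^ ((d : ℂ) / 2) := by
    rw [Complex.ofReal_cpow (by positivity)]; push_cast; rfl
  have hne : (((Real.pi / (1 / (2 * t))) ^ (d / 2 : ℝ) : ℝ) : ℂ) ≠ 0 := by
    rw [Complex.ofReal_ne_zero]; positivity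
  simp only [finrank_euclideanSpace, Fintype.card_fin] at h
  rw [← hc] at h
  have h2 : ∀ x : E d, heatKernel t x • Complex.exp (inner ℝ x ξ * Complex.I)
      = (((Real.pi / (1 / (2 * t))) ^ (d / 2 : ℝ) : ℝ) : ℂ)⁻¹ *
        Complex.exp (-((1 / (2 * t) : ℝ) : ℂ) * ‖x‖ ^ 2 + Complex.I * inner ℝ ξ x) := by
    intro x
    rw [Complex.exp_add, heatKernel, Complex.real_smul, real_inner_comm]
    push_cast
    ring_nf
  simp_rw [h2]
  rw [integral_const_mul, h, inv_mul_cancel_left₀ hne]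
  congr 1
  have : (t : ℂ) ≠ 0 := by exact_mod_cast ht.ne'
  push_cast
  rw [Complex.I_sq]
  field_simp
  norm_num

/-- Links the noise added by the algorithm to the explicit kernel, by comparing characteristic
functions. -/
theorem map_sqrt_smul_stdGaussian {t : ℝ} (ht : 0 < t) :
    (stdGaussian (E d)).map (fun z => √t • z) = ofDensity (heatKernel t) := by
  have := isProbabilityMeasure_heatKernel (d := d) ht
  have : IsProbabilityMeasure ((stdGaussian (E d)).map (fun z => √t • z)) :=
    Measure.isProbabilityMeasure_map (by fun_prop)
  refine Measure.ext_of_charFun ?_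
  ext ξ
  rw [charFun_map_smul, charFun_stdGaussian, charFun_heatKernel ht]
  congr 1
  rw [norm_smul, Real.norm_eq_abs, abs_of_nonneg (Real.sqrt_nonneg _)]
  have : ((√t : ℝ) : ℂ) ^ 2 = t := by exact_mod_cast Real.sq_sqrt ht.le
  push_cast
  rw [mul_pow, this]
  ring

theorem lintegral_norm_sq_stdGaussian :
    ∫⁻ z, ‖z‖ₑ ^ 2 ∂(stdGaussian (E d)) = d := by
  have h1 : ∫⁻ x, ENNReal.ofReal (x ^ 2) ∂(gaussianReal 0 1) = 1 := by
    have hm : MemLp id 2 (gaussianReal 0 1) := IsGaussian.memLp_two_id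
    have hv := variance_id_gaussianReal (μ := 0) (v := 1)
    rw [variance_of_integral_eq_zero (by fun_prop) (by simp)] at hv
    rw [← ofReal_integral_eq_lintegral_ofReal (by simpa using hm.integrable_sq)
      (.of_forall fun x => sq_nonneg x)]
    simp only [id] at hv
    simp [hv]
  rw [← map_pi_eq_stdGaussian, lintegral_map (by fun_prop) (by fun_prop)]
  have h2 : ∀ x : Fin d → ℝ, ‖WithLp.toLp 2 x‖ₑ ^ 2 = ∑ i, ENNReal.ofReal (x i ^ 2) := by
    intro x
    rw [← ofReal_norm, ← ENNReal.ofReal_pow (norm_nonneg _),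
      EuclideanSpace.real_norm_sq_eq, ENNReal.ofReal_sum_of_nonneg fun i _ => sq_nonneg _]
  simp_rw [h2]
  rw [lintegral_finsetSum _ (by fun_prop)]
  have h3 : ∀ i : Fin d, ∫⁻ x : Fin d → ℝ, ENNReal.ofReal (x i ^ 2)
      ∂(Measure.pi fun _ => gaussianReal 0 1) = 1 := fun i => by
    rw [← h1]
    exact (measurePreserving_eval (fun _ : Fin d => gaussianReal 0 1) i).lintegral_comp
      (f := fun x => ENNReal.ofReal (x ^ 2)) (by fun_prop)
  simp [h3]

theorem lintegral_heatKernel_mul_norm_sq {t : ℝ} (ht : 0 < t) :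
    ∫⁻ z : E d, ENNReal.ofReal (heatKernel t z) * ‖z‖ₑ ^ 2 = ENNReal.ofReal (t * d) := by
  rw [← lintegral_ofDensity (continuous_heatKernel t).measurable (by fun_prop),
    ← map_sqrt_smul_stdGaussian ht, lintegral_map (by fun_prop) (by fun_prop)]
  simp_rw [enorm_smul, mul_pow]
  rw [lintegral_const_mul _ (by fun_prop), lintegral_norm_sq_stdGaussian,
    Real.enorm_eq_ofReal (Real.sqrt_nonneg _), ← ENNReal.ofReal_pow (Real.sqrt_nonneg _),
    Real.sq_sqrt ht.le, ENNReal.ofReal_mul ht.le, ENNReal.ofReal_natCast]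

/-! ### Cauchy–Schwarz inequalities -/

/-- Cauchy–Schwarz in L²(w) against the constant 1; extended nonnegative integrals make any
integrability condition on h unnecessary. -/
theorem enorm_integral_smul_sq_le {w : E d → ℝ} (hw : Measurable w) (hw0 : ∀ x, 0 ≤ w x)
    {h : E d → E d} (hh : Measurable h) :
    ‖∫ x, w x • h x‖ₑ ^ 2 ≤
      (∫⁻ x, ENNReal.ofReal (w x)) * ∫⁻ x, ENNReal.ofReal (w x) * ‖h x‖ₑ ^ 2 := by
  have h1 : ‖∫ x, w x • h x‖ₑ ≤ ∫⁻ x, ENNReal.ofReal (w x) * ‖h x‖ₑ := by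
    refine (enorm_integral_le_lintegral_enorm _).trans_eq ?_
    simp_rw [enorm_smul, Real.enorm_eq_ofReal (hw0 _)]
  have h2 := ENNReal.lintegral_mul_le_Lp_mul_Lq (ofDensity w) Real.HolderConjugate.two_two
    (f := fun _ => 1) (g := fun x => ‖h x‖ₑ) (by fun_prop) (by fun_prop)
  simp only [Pi.mul_apply, one_mul, ENNReal.rpow_two, one_pow] at h2
  rw [lintegral_ofDensity hw (by fun_prop), lintegral_ofDensity hw (by fun_prop),
    lintegral_ofDensity hw (by fun_prop)] at h2
  simp only [mul_one] at h2
  have h3 := pow_le_pow_left' (h1.trans h2) 2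
  rwa [mul_pow, ← ENNReal.rpow_mul_natCast, ← ENNReal.rpow_mul_natCast, Nat.cast_ofNat,
    show (1 / 2 : ℝ) * 2 = 1 by norm_num, ENNReal.rpow_one, ENNReal.rpow_one] at h3

/-- This is the joint convexity of (a, α) ↦ a²/α, in a product form that survives the values 0 and
∞. It follows from Cauchy–Schwarz in ℝ² for the square roots. -/
theorem add_sq_le_add_mul_add {a b α β A B : ℝ≥0∞} (ha : a ^ 2 ≤ α * A) (hb : b ^ 2 ≤ β * B) :
    (a + b) ^ 2 ≤ (α + β) * (A + B) := by
  have key : ∀ {a α A : ℝ≥0∞}, a ^ 2 ≤ α * A → a ≤ α ^ (1 / 2 : ℝ) * A ^ (1 / 2 : ℝ) := by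
    intro a α A h
    have := ENNReal.rpow_le_rpow h (show (0 : ℝ) ≤ 1 / 2 by norm_num)
    rwa [← ENNReal.rpow_natCast_mul, Nat.cast_ofNat, show (2 : ℝ) * (1 / 2) = 1 by norm_num,
      ENNReal.rpow_one, ENNReal.mul_rpow_of_nonneg _ _ (by norm_num)] at this
  have hsq : ∀ x : ℝ≥0∞, (x ^ (1 / 2 : ℝ)) ^ (2 : ℝ) = x := fun x => by
    rw [← ENNReal.rpow_mul]; norm_num
  have h := ENNReal.inner_le_Lp_mul_Lq (Finset.univ : Finset (Fin 2))
    (![α ^ (1 / 2 : ℝ), β ^ (1 / 2 : ℝ)]) (![A ^ (1 / 2 : ℝ), B ^ (1 / 2 : ℝ)])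
    Real.HolderConjugate.two_two
  simp only [Fin.sum_univ_two, Matrix.cons_val_zero, Matrix.cons_val_one, hsq] at h
  have h3 := pow_le_pow_left' ((add_le_add (key ha) (key hb)).trans h) 2
  rwa [mul_pow, ← ENNReal.rpow_mul_natCast, ← ENNReal.rpow_mul_natCast, Nat.cast_ofNat,
    show (1 / 2 : ℝ) * 2 = 1 by norm_num, ENNReal.rpow_one, ENNReal.rpow_one] at h3

/-! ### Classical gradients are weak gradients -/

theorem hasGradientAt_iff_innerSL {f : E d → ℝ} {v x : E d} :
    HasGradientAt f v x ↔ HasFDerivAt f (innerSL ℝ v) x := Iff.rfl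

/-- Integration by parts along each fixed direction v; the compact support of φ supplies all the
integrability. -/
theorem HasWeakGradient.of_hasGradientAt {f : E d → ℝ} {g : E d → E d}
    (hfg : ∀ x, HasGradientAt f (g x) x) (hg : Continuous g) : HasWeakGradient f g := by
  have hf : Continuous f :=
    continuous_iff_continuousAt.2 fun x => (hfg x).hasFDerivAt.continuousAt
  refine ⟨hf.locallyIntegrable, hg.locallyIntegrable, fun φ hφ hc => ?_⟩
  have hφd : Differentiable ℝ φ := hφ.differentiable (by simp)
  have hφ' : Continuous (gradient φ) :=
    (InnerProductSpace.toDual ℝ (E d)).symm.continuous.comp (hφ.continuous_fderiv (by simp))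
  have hcφ' : HasCompactSupport (gradient φ) :=
    (hc.fderiv ℝ).comp_left (g := (InnerProductSpace.toDual ℝ (E d)).symm) (map_zero _)
  have hgφ : ∀ x v, fderiv ℝ φ x v = inner ℝ v (gradient φ x) := fun x v => by
    rw [real_inner_comm, inner_gradient_left]
  have hgf : ∀ x v, fderiv ℝ f x v = inner ℝ v (g x) := fun x v => by
    rw [real_inner_comm, (hasGradientAt_iff_innerSL.1 (hfg x)).fderiv, innerSL_apply_apply]
  have i1 : Integrable (fun x => f x • gradient φ x) :=
    (hf.smul hφ').integrable_of_hasCompactSupport (hcφ'.smul_left (f := f))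
  have i2 : Integrable (fun x => φ x • g x) :=
    (hφ.continuous.smul hg).integrable_of_hasCompactSupport (hc.smul_right (f' := g))
  have i3 : Integrable (fun x => f x * φ x) :=
    (hf.mul hφ.continuous).integrable_of_hasCompactSupport (hc.mul_left (f := f))
  refine ext_inner_left ℝ fun v => ?_
  rw [inner_neg_right, ← integral_inner i1, ← integral_inner i2]
  have := integral_mul_fderiv_eq_neg_fderiv_mul_of_integrable (μ := (volume : Measure (E d)))
    (f := f) (g := φ) (v := v) ?_ ?_ i3 (fun x _ => (hfg x).differentiableAt) fun x _ => hφd x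
  · simpa only [inner_smul_right, hgφ, hgf, mul_comm] using this
  · simpa only [inner_smul_right, hgf, mul_comm] using i2.const_inner (𝕜 := ℝ) v
  · simpa only [inner_smul_right, hgφ] using i1.const_inner (𝕜 := ℝ) v

/-! ### The target density -/

namespace IsLogSmoothPotential

variable {β : ℝ} {V : E d → ℝ}

theorem integral_exp_neg_pos (hV : IsLogSmoothPotential β V) : 0 < ∫ x, Real.exp (-V x) :=
  integral_exp_pos hV.integrable_exp_neg

theorem targetDensity_pos (hV : IsLogSmoothPotential β V) (x : E d) : 0 < targetDensity V x :=
  div_pos (Real.exp_pos _) hV.integral_exp_neg_pos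

theorem hasGradientAt (hV : IsLogSmoothPotential β V) (x : E d) :
    HasGradientAt V (gradient V x) x :=
  (hV.contDiff.differentiable (by simp) x).hasGradientAt

theorem continuous (hV : IsLogSmoothPotential β V) : Continuous V := hV.contDiff.continuous

theorem continuous_gradient (hV : IsLogSmoothPotential β V) : Continuous (gradient V) :=
  (InnerProductSpace.toDual ℝ (E d)).symm.continuous.comp
    (hV.contDiff.continuous_fderiv (by simp))

theorem continuous_targetDensity (hV : IsLogSmoothPotential β V) :
    Continuous (targetDensity V) := by
  have := hV.continuous
  unfold targetDensity; fun_prop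

theorem hasFDerivAt_targetDensity (hV : IsLogSmoothPotential β V) (x : E d) :
    HasFDerivAt (targetDensity V) (innerSL ℝ (-(targetDensity V x) • gradient V x)) x := by
  have h := (hasGradientAt_iff_innerSL.1 (hV.hasGradientAt x)).neg.exp.mul_const
    (∫ y, Real.exp (-V y))⁻¹
  refine h.congr_fderiv ?_
  ext v
  simp only [targetDensity, map_smul, _root_.smul_apply, _root_.neg_apply, Pi.neg_apply,
    innerSL_apply_apply, smul_eq_mul]
  ring

theorem integrable_targetDensity (hV : IsLogSmoothPotential β V) :
    Integrable (targetDensity V) := hV.integrable_exp_neg.div_const _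

theorem integral_targetDensity (hV : IsLogSmoothPotential β V) :
    ∫ x, targetDensity V x = 1 := by
  unfold targetDensity
  rw [integral_div, div_self hV.integral_exp_neg_pos.ne']

/-- The relative Fisher information of a positive `C¹` density. -/
theorem fisherInfo_ofDensity_le (hV : IsLogSmoothPotential β V) {Q : E d → ℝ} {G : E d → E d}
    (hQ : ∀ x, 0 < Q x) (hQG : ∀ x, HasGradientAt Q (G x) x) (hG : Continuous G) :
    fisherInfo (ofDensity Q) (target V) ≤
      ∫⁻ x, ‖G x + Q x • gradient V x‖ₑ ^ 2 / ENNReal.ofReal (Q x) := by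
  have hπ := hV.targetDensity_pos
  have hcπ := hV.continuous_targetDensity
  have hcV := hV.continuous_gradient
  have hcQ : Continuous Q :=
    continuous_iff_continuousAt.2 fun x => (hQG x).hasFDerivAt.continuousAt
  have hcf : Continuous fun x => Q x / targetDensity V x := hcQ.div hcπ fun x => (hπ x).ne'
  have hcg : Continuous fun x => (targetDensity V x)⁻¹ • (G x + Q x • gradient V x) :=
    (hcπ.inv₀ fun x => (hπ x).ne').smul (hG.add (hcQ.smul hcV))
  -- An upper bound on the infimum needs only one admissible pair. Since ∇(1/π) = ∇V/π, the gradient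
  -- of Q/π is (G + Q∇V)/π, and π cancels in the quotient of the two.
  refine (iInf₂_le (fun x => Q x / targetDensity V x)
    fun x => (targetDensity V x)⁻¹ • (G x + Q x • gradient V x)).trans
    ((iInf_le _ ⟨hcf.measurable, fun x => by have := hQ x; have := hπ x; positivity, ?_,
      HasWeakGradient.of_hasGradientAt (fun x => ?_) hcg⟩).trans_eq ?_)
  rotate_left
  · unfold target ofDensity
    rw [← withDensity_mul _ (by fun_prop) (by fun_prop)]
    congr 1
    ext x
    rw [Pi.mul_apply, ← ENNReal.ofReal_mul (hπ x).le, mul_div_cancel₀ _ (hπ x).ne']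
  · have hinv := (hasDerivAt_inv (hπ x).ne').comp_hasFDerivAt x (hV.hasFDerivAt_targetDensity x)
    have h := (hasGradientAt_iff_innerSL.1 (hQG x)).mul hinv
    refine hasGradientAt_iff_innerSL.2 (h.congr_fderiv ?_)
    ext v
    have := (hπ x).ne'
    simp only [map_smul, map_add, _root_.smul_apply, _root_.add_apply, Function.comp_apply,
      innerSL_apply_apply, smul_eq_mul]
    field_simp
    ring
  · rw [lintegral_ofDensity hcQ.measurable (Measurable.pow_const (by fun_prop) _)]
    refine lintegral_congr fun x => ?_
    have h1 := (hπ x).ne'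
    have h2 := (hQ x).ne'
    rw [smul_smul, inv_div, div_mul_eq_mul_div, mul_inv_cancel₀ h1, one_div, enorm_smul,
      enorm_inv h2, Real.enorm_eq_ofReal (hQ x).le, mul_pow, ← mul_assoc, ENNReal.div_eq_inv_mul]
    congr 1
    have h3 : ENNReal.ofReal (Q x) ≠ 0 := by simpa using hQ x
    rw [pow_two, ← mul_assoc, ENNReal.mul_inv_cancel h3 ENNReal.ofReal_ne_top, one_mul]

end IsLogSmoothPotential

/-! ### The heat flow of a density -/

/-- The density at time `t` of the heat flow started from the density `q`. -/
def heatFlow (t : ℝ) (q : E d → ℝ) (y : E d) : ℝ := ∫ x, q x * heatKernel t (y - x)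

/-- The gradient of `heatFlow t q`. -/
def heatFlowGradient (t : ℝ) (q : E d → ℝ) (y : E d) : E d :=
  ∫ x, (q x * heatKernel t (y - x)) • (-t⁻¹) • (y - x)

theorem norm_mul_heatKernel_smul_le {t K : ℝ} (ht : 0 < t)
    (hK : ∀ z : E d, (1 + ‖z‖) * heatKernel t z ≤ K) {F : Type*} [NormedAddCommGroup F]
    [NormedSpace ℝ F] {w : F} {c : ℝ} (hc0 : 0 ≤ c) (a : ℝ) {z : E d}
    (hc : ‖w‖ ≤ c * (1 + ‖z‖)) : ‖(a * heatKernel t z) • w‖ ≤ ‖a‖ * (c * K) := by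
  have hk := (heatKernel_pos ht z).le
  rw [norm_smul, norm_mul, Real.norm_of_nonneg hk, mul_assoc]
  refine mul_le_mul_of_nonneg_left ?_ (norm_nonneg _)
  calc heatKernel t z * ‖w‖ ≤ heatKernel t z * (c * (1 + ‖z‖)) := by gcongr
    _ = c * ((1 + ‖z‖) * heatKernel t z) := by ring
    _ ≤ c * K := by gcongr; exact hK _

/-- Linear growth covers every field integrated below: constants, (y - x)/t and ∇V. -/
theorem integrable_mul_heatKernel_smul {t : ℝ} (ht : 0 < t) {q : E d → ℝ} (hq : Integrable q)
    {F : Type*} [NormedAddCommGroup F] [NormedSpace ℝ F] {h : E d → F} {c : ℝ} {y : E d}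
    (hh : AEStronglyMeasurable h) (hc : ∀ x, ‖h x‖ ≤ c * (1 + ‖y - x‖)) :
    Integrable fun x => (q x * heatKernel t (y - x)) • h x := by
  obtain ⟨K, hK⟩ := exists_heatKernel_bound (d := d) ht
  have hcont := continuous_heatKernel (d := d) t
  have hc0 : 0 ≤ c := by
    have := (norm_nonneg _).trans (hc y)
    simpa using this
  refine (hq.norm.mul_const (c * K)).mono'
    ((hq.aestronglyMeasurable.mul (by fun_prop)).smul hh) (.of_forall fun x => ?_)
  exact norm_mul_heatKernel_smul_le ht hK hc0 _ (hc x)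

theorem integrable_mul_heatKernel {t : ℝ} (ht : 0 < t) {q : E d → ℝ} (hq : Integrable q)
    (y : E d) : Integrable fun x => q x * heatKernel t (y - x) := by
  simpa using integrable_mul_heatKernel_smul ht hq (h := fun _ => (1 : ℝ)) (c := 1) (y := y)
    (by fun_prop) (fun x => by simp)

theorem ofReal_heatFlow {t : ℝ} (ht : 0 < t) {q : E d → ℝ} (hq : Integrable q)
    (hq0 : ∀ x, 0 ≤ q x) (y : E d) :
    ENNReal.ofReal (heatFlow t q y) = ∫⁻ x, ENNReal.ofReal (q x * heatKernel t (y - x)) :=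
  ofReal_integral_eq_lintegral_ofReal (integrable_mul_heatKernel ht hq y)
    (.of_forall fun x => mul_nonneg (hq0 x) (heatKernel_pos ht _).le)

theorem heatFlow_pos {t : ℝ} (ht : 0 < t) {q : E d → ℝ} (hq : Integrable q)
    (hq0 : ∀ x, 0 < q x) (y : E d) : 0 < heatFlow t q y := by
  have hpos : ∀ x, 0 < q x * heatKernel t (y - x) := fun x =>
    mul_pos (hq0 x) (heatKernel_pos ht _)
  refine (integral_pos_iff_support_of_nonneg (fun x => (hpos x).le)
    (integrable_mul_heatKernel ht hq y)).2 ?_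
  have : Function.support (fun x => q x * heatKernel t (y - x)) = Set.univ :=
    Set.eq_univ_of_forall fun x => (hpos x).ne'
  rw [this]
  exact isOpen_univ.measure_pos _ Set.univ_nonempty

theorem norm_neg_inv_smul_le {t : ℝ} (ht : 0 < t) (z : E d) :
    ‖(-t⁻¹) • z‖ ≤ t⁻¹ * (1 + ‖z‖) := by
  rw [norm_smul, norm_neg, Real.norm_of_nonneg (by positivity)]
  gcongr
  linarith

/-- Differentiation under the integral. The dominating function ‖q‖ t⁻¹ K does not depend on y, so
integrability of q suffices. -/
theorem hasGradientAt_heatFlow {t : ℝ} (ht : 0 < t) {q : E d → ℝ} (hq : Integrable q) (y : E d) :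
    HasGradientAt (heatFlow t q) (heatFlowGradient t q y) y := by
  obtain ⟨K, hK⟩ := exists_heatKernel_bound (d := d) ht
  have hcont := continuous_heatKernel (d := d) t
  have hint : ∀ y : E d, Integrable fun x => (q x * heatKernel t (y - x)) • (-t⁻¹) • (y - x) :=
    fun y => integrable_mul_heatKernel_smul ht hq (by fun_prop)
      fun x => norm_neg_inv_smul_le ht _
  have h := hasFDerivAt_integral_of_dominated_of_fderiv_le (𝕜 := ℝ)
    (μ := (volume : Measure (E d)))
    (F := fun y x => q x * heatKernel t (y - x))
    (F' := fun y x => innerSL ℝ ((q x * heatKernel t (y - x)) • (-t⁻¹) • (y - x)))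
    (bound := fun x => ‖q x‖ * (t⁻¹ * K)) (s := Set.univ) (x₀ := y) Filter.univ_mem
    (.of_forall fun y => (integrable_mul_heatKernel ht hq y).aestronglyMeasurable)
    (integrable_mul_heatKernel ht hq y)
    ((innerSL ℝ).continuous.comp_aestronglyMeasurable (hint y).aestronglyMeasurable)
    (.of_forall fun x z _ => ?_) (hq.norm.mul_const _) (.of_forall fun x z _ => ?_)
  · refine hasGradientAt_iff_innerSL.2 (h.congr_fderiv ?_)
    ext v
    rw [ContinuousLinearMap.integral_apply
      ((hint y).norm.mono ((innerSL ℝ).continuous.comp_aestronglyMeasurable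
        (hint y).aestronglyMeasurable) (.of_forall fun x => by rw [innerSL_apply_norm, norm_norm])),
      innerSL_apply_apply,
      heatFlowGradient, real_inner_comm, ← integral_inner (hint y)]
    simp only [innerSL_apply_apply]
    exact integral_congr_ae (.of_forall fun x => real_inner_comm _ _)
  · rw [innerSL_apply_norm]
    exact norm_mul_heatKernel_smul_le ht hK (by positivity) _ (norm_neg_inv_smul_le ht _)
  · have h1 := ((hasFDerivAt_heatKernel ht (z - x)).comp z
      ((hasFDerivAt_id z).sub_const x)).const_mul (q x)
    refine h1.congr_fderiv ?_
    ext v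
    simp only [map_smul, _root_.smul_apply, innerSL_apply_apply, smul_eq_mul,
      ContinuousLinearMap.comp_apply, ContinuousLinearMap.id_apply]
    ring

theorem continuous_heatFlowGradient {t : ℝ} (ht : 0 < t) {q : E d → ℝ} (hq : Integrable q) :
    Continuous (heatFlowGradient t q) := by
  obtain ⟨K, hK⟩ := exists_heatKernel_bound (d := d) ht
  have hcont := continuous_heatKernel (d := d) t
  refine continuous_of_dominated (bound := fun x => ‖q x‖ * (t⁻¹ * K))
    (fun y => (integrable_mul_heatKernel_smul ht hq (by fun_prop)
      fun x => norm_neg_inv_smul_le ht _).aestronglyMeasurable)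
    (fun z => .of_forall fun x => ?_) (hq.norm.mul_const _) (.of_forall fun x => by fun_prop)
  exact norm_mul_heatKernel_smul_le ht hK (by positivity) _ (norm_neg_inv_smul_le ht _)

/-- By Tonelli, y is integrated first; for each x the inner integral is the Gaussian second moment
td. -/
theorem lintegral_lintegral_heatKernel_mul {t : ℝ} (ht : 0 < t) {q : E d → ℝ}
    (hq : Integrable q) (hqm : Measurable q) (hq0 : ∀ x, 0 ≤ q x) (hq1 : ∫ x, q x = 1) :
    ∫⁻ y, ∫⁻ x, ENNReal.ofReal (q x * heatKernel t (y - x)) * ‖y - x‖ₑ ^ 2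
      = ENNReal.ofReal (t * d) := by
  have hcont := continuous_heatKernel (d := d) t
  rw [lintegral_lintegral_swap (by fun_prop)]
  have h : ∀ x : E d, ∫⁻ y, ENNReal.ofReal (q x * heatKernel t (y - x)) * ‖y - x‖ₑ ^ 2
      = ENNReal.ofReal (q x) * ENNReal.ofReal (t * d) := fun x => by
    rw [← lintegral_heatKernel_mul_norm_sq ht, ← lintegral_const_mul _ (by fun_prop),
      ← lintegral_sub_right_eq_self (fun z => ENNReal.ofReal (q x) *
        (ENNReal.ofReal (heatKernel t z) * ‖z‖ₑ ^ 2)) x]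
    simp_rw [ENNReal.ofReal_mul (hq0 x), mul_assoc]
  simp_rw [h]
  rw [lintegral_mul_const _ (by fun_prop), ← ofReal_integral_eq_lintegral_ofReal hq
    (.of_forall hq0), hq1, ENNReal.ofReal_one, one_mul]

/-! ### The score of the heat flow of the target -/

theorem IsLogSmoothPotential.integrable_mul_gradient {t : ℝ} (ht : 0 < t) {V : E d → ℝ}
    (hV : IsLogSmoothPotential 1 V) {q : E d → ℝ} (hq : Integrable q) (y : E d) :
    Integrable fun x => (q x * heatKernel t (y - x)) • gradient V x := by
  refine integrable_mul_heatKernel_smul ht hq (c := 1 + ‖gradient V y‖)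
    hV.continuous_gradient.aestronglyMeasurable fun x => ?_
  have h1 := hV.gradient_lipschitz y x
  have h2 := norm_sub_norm_le (gradient V x) (gradient V y)
  rw [norm_sub_rev] at h2
  nlinarith [norm_nonneg (gradient V y), norm_nonneg (y - x)]

/-- Integration by parts moves the derivative from the kernel to π, where ∇π = -π∇V. This removes
the factor t⁻¹; integrability of the products rules out boundary terms. -/
theorem IsLogSmoothPotential.heatFlowGradient_targetDensity {t : ℝ} (ht : 0 < t) {V : E d → ℝ}
    (hV : IsLogSmoothPotential 1 V) (y : E d) :
    heatFlowGradient t (targetDensity V) y =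
      -∫ x, (targetDensity V x * heatKernel t (y - x)) • gradient V x := by
  have hq := hV.integrable_targetDensity
  have i1 : Integrable fun x => (targetDensity V x * heatKernel t (y - x)) • (-t⁻¹) • (y - x) :=
    integrable_mul_heatKernel_smul ht hq (by fun_prop) fun x => norm_neg_inv_smul_le ht _
  have i2 := hV.integrable_mul_gradient ht hq y
  have hk : ∀ x, HasFDerivAt (fun x => heatKernel t (y - x))
      (innerSL ℝ ((heatKernel t (y - x) / t) • (y - x))) x := fun x => by
    have h1 := (hasFDerivAt_heatKernel ht (y - x)).comp x ((hasFDerivAt_id x).const_sub y)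
    refine h1.congr_fderiv ?_
    ext v
    simp
  refine ext_inner_left ℝ fun v => ?_
  rw [heatFlowGradient, inner_neg_right, ← integral_inner i1, ← integral_inner i2]
  have e1 : ∀ x, inner ℝ v ((targetDensity V x * heatKernel t (y - x)) • (-t⁻¹) • (y - x))
      = -(targetDensity V x * fderiv ℝ (fun x => heatKernel t (y - x)) x v) := fun x => by
    rw [(hk x).fderiv, innerSL_apply_apply, real_inner_comm, inner_smul_left, inner_smul_left,
      inner_smul_left]
    simp only [conj_trivial]
    ring
  have e2 : ∀ x, inner ℝ v ((targetDensity V x * heatKernel t (y - x)) • gradient V x)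
      = -(fderiv ℝ (targetDensity V) x v * heatKernel t (y - x)) := fun x => by
    rw [(hV.hasFDerivAt_targetDensity x).fderiv, innerSL_apply_apply, real_inner_comm,
      inner_smul_left, inner_smul_left]
    simp only [conj_trivial]
    ring
  have j1 := (i1.const_inner (𝕜 := ℝ) v)
  have j2 := (i2.const_inner (𝕜 := ℝ) v)
  simp only [e1, e2] at j1 j2 ⊢
  rw [integral_neg, integral_neg, neg_neg, integral_mul_fderiv_eq_neg_fderiv_mul_of_integrable
    (by simpa using j2.neg) (by simpa using j1.neg) (integrable_mul_heatKernel ht hq y)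
    (fun x _ => (hV.hasFDerivAt_targetDensity x).differentiableAt)
    (fun x _ => (hk x).differentiableAt), neg_neg]

/-! ### Relative Fisher information along the heat flow -/

/-- The conditional mean square displacement of the heat flow started from `q`, times the density
of the heat flow. -/
def displacement (t : ℝ) (q : E d → ℝ) (y : E d) : ℝ≥0∞ :=
  ∫⁻ x, ENNReal.ofReal (q x * heatKernel t (y - x)) * ‖y - x‖ₑ ^ 2

theorem measurable_displacement (t : ℝ) {q : E d → ℝ} (hq : Measurable q) :
    Measurable (displacement t q) := by
  have hcont := continuous_heatKernel (d := d) t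
  exact Measurable.lintegral_prod_right' (f := fun p : E d × E d =>
    ENNReal.ofReal (q p.2 * heatKernel t (p.1 - p.2)) * ‖p.1 - p.2‖ₑ ^ 2) (by fun_prop)

/-- Used with c = 1 for the score of π_t relative to π, and with c = 1 + t⁻¹ for ∇V itself. -/
theorem enorm_integral_heatKernel_smul_sq_le {t : ℝ} (ht : 0 < t) {q : E d → ℝ}
    (hq : Integrable q) (hqm : Measurable q) (hq0 : ∀ x, 0 ≤ q x) (y : E d) {h : E d → E d}
    (hh : Measurable h) {c : ℝ} (hc0 : 0 ≤ c) (hc : ∀ x, ‖h x‖ ≤ c * ‖y - x‖) :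
    ‖∫ x, (q x * heatKernel t (y - x)) • h x‖ₑ ^ 2 ≤
      ENNReal.ofReal (heatFlow t q y) * (ENNReal.ofReal (c ^ 2) * displacement t q y) := by
  have hcont := continuous_heatKernel (d := d) t
  refine (enorm_integral_smul_sq_le (by fun_prop)
    (fun x => mul_nonneg (hq0 x) (heatKernel_pos ht _).le) hh).trans ?_
  rw [ofReal_heatFlow ht hq hq0]
  refine mul_le_mul_right ?_ _
  rw [displacement, ← lintegral_const_mul _ (by fun_prop)]
  refine lintegral_mono fun x => ?_
  rw [mul_left_comm]
  gcongr
  rw [ENNReal.ofReal_pow hc0, ← mul_pow, ← ofReal_norm, ← ofReal_norm, ← ENNReal.ofReal_mul hc0]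
  gcongr
  exact hc x

theorem integral_heatKernel_smul_const {t : ℝ} (q : E d → ℝ) (y v : E d) :
    ∫ x, (q x * heatKernel t (y - x)) • v = heatFlow t q y • v :=
  integral_smul_const _ _

namespace IsLogSmoothPotential

variable {V : E d → ℝ} {t : ℝ}

theorem heatFlowGradient_add_smul (ht : 0 < t) (hV : IsLogSmoothPotential 1 V) (y : E d) :
    heatFlowGradient t (targetDensity V) y + heatFlow t (targetDensity V) y • gradient V y =
      ∫ x, (targetDensity V x * heatKernel t (y - x)) • (gradient V y - gradient V x) := by
  have hq := hV.integrable_targetDensity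
  simp_rw [smul_sub]
  rw [integral_sub ((integrable_mul_heatKernel ht hq y).smul_const _)
    (hV.integrable_mul_gradient ht hq y), integral_heatKernel_smul_const,
    hV.heatFlowGradient_targetDensity ht, neg_add_eq_sub]

/-- Subtracting the two expressions for ∇π_t, one with the derivative on π and one with it on the
kernel, isolates ∇V(y) as an average of vectors of size O(‖y - x‖). Hence ∇V has a second moment
under π_t without any assumption on tails. -/
theorem heatFlow_smul_gradient (ht : 0 < t) (hV : IsLogSmoothPotential 1 V) (y : E d) :
    heatFlow t (targetDensity V) y • gradient V y =
      ∫ x, (targetDensity V x * heatKernel t (y - x)) •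
        (gradient V y - gradient V x - (-t⁻¹) • (y - x)) := by
  have hq := hV.integrable_targetDensity
  simp_rw [smul_sub _ (_ - _) ((-t⁻¹) • _)]
  rw [integral_sub, ← hV.heatFlowGradient_add_smul ht, ← heatFlowGradient, add_sub_cancel_left]
  · simp_rw [smul_sub]
    exact ((integrable_mul_heatKernel ht hq y).smul_const _).sub
      (hV.integrable_mul_gradient ht hq y)
  · exact integrable_mul_heatKernel_smul ht hq (by fun_prop) fun x => norm_neg_inv_smul_le ht _

theorem enorm_heatFlowGradient_add_smul_sq_le (ht : 0 < t) (hV : IsLogSmoothPotential 1 V)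
    (y : E d) :
    ‖heatFlowGradient t (targetDensity V) y
      + heatFlow t (targetDensity V) y • gradient V y‖ₑ ^ 2 ≤
      ENNReal.ofReal (heatFlow t (targetDensity V) y) * displacement t (targetDensity V) y := by
  have hc := hV.continuous_gradient.measurable
  rw [hV.heatFlowGradient_add_smul ht]
  simpa using enorm_integral_heatKernel_smul_sq_le ht hV.integrable_targetDensity
    hV.continuous_targetDensity.measurable (fun x => (hV.targetDensity_pos x).le) y
    (by fun_prop) zero_le_one (hV.gradient_lipschitz y)

theorem heatFlow_mul_enorm_gradient_sq_le (ht : 0 < t) (hV : IsLogSmoothPotential 1 V)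
    (y : E d) :
    ENNReal.ofReal (heatFlow t (targetDensity V) y) * ‖gradient V y‖ₑ ^ 2 ≤
      ENNReal.ofReal ((1 + t⁻¹) ^ 2) * displacement t (targetDensity V) y := by
  have hc := hV.continuous_gradient.measurable
  have hpos := heatFlow_pos ht hV.integrable_targetDensity hV.targetDensity_pos y
  have h := enorm_integral_heatKernel_smul_sq_le ht hV.integrable_targetDensity
    hV.continuous_targetDensity.measurable (fun x => (hV.targetDensity_pos x).le) y
    (h := fun x => gradient V y - gradient V x - (-t⁻¹) • (y - x)) (c := 1 + t⁻¹)
    (by fun_prop) (by positivity) fun x => by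
      refine (norm_sub_le _ _).trans ?_
      rw [norm_smul, norm_neg, Real.norm_of_nonneg (by positivity : 0 ≤ t⁻¹), add_mul]
      gcongr
      exact hV.gradient_lipschitz y x
  rw [← hV.heatFlow_smul_gradient ht, enorm_smul, Real.enorm_eq_ofReal hpos.le, mul_pow, sq,
    mul_assoc] at h
  -- One factor π_t(y), positive and finite, cancels.
  exact (ENNReal.mul_le_mul_iff_right (by simpa using hpos) ENNReal.ofReal_ne_top).1 h

/-- As q need not be differentiable, the derivative stays on the kernel and costs t⁻¹. The term in
∇V is passed to π by q_t ≤ c π_t. The crude size is harmless, since it is later multiplied by the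
failure probability. -/
theorem enorm_heatFlowGradient_add_smul_sq_le_of_le (ht : 0 < t)
    (hV : IsLogSmoothPotential 1 V) {q : E d → ℝ} (hq : Integrable q) (hqm : Measurable q)
    (hq0 : ∀ x, 0 ≤ q x) {c : ℝ} (hc0 : 0 ≤ c) (hqc : ∀ x, q x ≤ c * targetDensity V x)
    (y : E d) :
    ‖heatFlowGradient t q y + heatFlow t q y • gradient V y‖ₑ ^ 2 ≤
      ENNReal.ofReal (heatFlow t q y) *
        (2 * (ENNReal.ofReal (t⁻¹ ^ 2) * displacement t q y
          + ENNReal.ofReal (c * (1 + t⁻¹) ^ 2) * displacement t (targetDensity V) y)) := by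
  have hcont := continuous_heatKernel (d := d) t
  have hle : heatFlow t q y ≤ c * heatFlow t (targetDensity V) y := by
    rw [heatFlow, heatFlow, ← integral_const_mul]
    refine integral_mono (integrable_mul_heatKernel ht hq y)
      ((integrable_mul_heatKernel ht hV.integrable_targetDensity y).const_mul c) fun x => ?_
    simp only [← mul_assoc]
    exact mul_le_mul_of_nonneg_right (hqc x) (heatKernel_pos ht _).le
  have hsum : heatFlowGradient t q y + heatFlow t q y • gradient V y =
      ∫ x, (q x * heatKernel t (y - x)) • ((-t⁻¹) • (y - x) + gradient V y) := by
    simp_rw [smul_add]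
    rw [integral_add (integrable_mul_heatKernel_smul ht hq (by fun_prop)
      fun x => norm_neg_inv_smul_le ht _) ((integrable_mul_heatKernel ht hq y).smul_const _),
      integral_heatKernel_smul_const, heatFlowGradient]
  rw [hsum]
  refine (enorm_integral_smul_sq_le (by fun_prop)
    (fun x => mul_nonneg (hq0 x) (heatKernel_pos ht _).le) (by fun_prop)).trans ?_
  rw [← ofReal_heatFlow ht hq hq0]
  gcongr
  calc ∫⁻ x, ENNReal.ofReal (q x * heatKernel t (y - x))
          * ‖(-t⁻¹) • (y - x) + gradient V y‖ₑ ^ 2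
      ≤ ∫⁻ x, 2 * (ENNReal.ofReal (t⁻¹ ^ 2) *
          (ENNReal.ofReal (q x * heatKernel t (y - x)) * ‖y - x‖ₑ ^ 2) +
          ENNReal.ofReal (q x * heatKernel t (y - x)) * ‖gradient V y‖ₑ ^ 2) := by
        refine lintegral_mono fun x => ?_
        have h1 : ‖(-t⁻¹) • (y - x) + gradient V y‖ₑ ^ 2
            ≤ 2 * (ENNReal.ofReal (t⁻¹ ^ 2) * ‖y - x‖ₑ ^ 2 + ‖gradient V y‖ₑ ^ 2) := by
          have ht' : (0 : ℝ) ≤ t⁻¹ := by positivity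
          refine (pow_le_pow_left' (enorm_add_le _ _) 2).trans ?_
          have := add_sq_le_add_mul_add (one_mul (‖(-t⁻¹) • (y - x)‖ₑ ^ 2)).ge
            (one_mul (‖gradient V y‖ₑ ^ 2)).ge
          rwa [one_add_one_eq_two, enorm_smul, enorm_neg, Real.enorm_eq_ofReal ht', mul_pow,
            ← ENNReal.ofReal_pow ht', ← Real.enorm_eq_ofReal ht', ← enorm_neg t⁻¹,
            ← enorm_smul] at this
        refine (mul_le_mul_right h1 _).trans_eq ?_
        ring
    _ = 2 * (ENNReal.ofReal (t⁻¹ ^ 2) * displacement t q y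
          + ENNReal.ofReal (heatFlow t q y) * ‖gradient V y‖ₑ ^ 2) := by
        rw [lintegral_const_mul _ (by fun_prop), lintegral_add_left (by fun_prop),
          lintegral_const_mul _ (by fun_prop), lintegral_mul_const _ (by fun_prop),
          ofReal_heatFlow ht hq hq0, displacement]
    _ ≤ _ := by
        gcongr 2 * (_ + ?_)
        refine (mul_le_mul_left (ENNReal.ofReal_le_ofReal hle) _).trans ?_
        rw [ENNReal.ofReal_mul hc0, ENNReal.ofReal_mul hc0, mul_assoc, mul_assoc]
        refine mul_le_mul_right ?_ _
        exact hV.heatFlow_mul_enorm_gradient_sq_le ht y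

/-- Heat flow regularizes a mixture of the target with a warm start. -/
theorem fisherInfo_heatFlow_mixture_le (ht : 0 < t) (hV : IsLogSmoothPotential 1 V)
    {q : E d → ℝ} (hq : Integrable q) (hqm : Measurable q) (hq0 : ∀ x, 0 < q x)
    (hq1 : ∫ x, q x = 1) {c : ℝ} (hc0 : 0 ≤ c) (hqc : ∀ x, q x ≤ c * targetDensity V x)
    {δ : ℝ} (hδ0 : 0 ≤ δ) (hδ1 : δ ≤ 1) :
    fisherInfo (ofDensity fun y => (1 - δ) * heatFlow t (targetDensity V) y
        + δ * heatFlow t q y) (target V) ≤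
      ENNReal.ofReal ((1 - δ) * (t * d)
        + δ * (2 * (t⁻¹ ^ 2 * (t * d) + c * (1 + t⁻¹) ^ 2 * (t * d)))) := by
  have hπ := hV.integrable_targetDensity
  have hπm := hV.continuous_targetDensity.measurable
  have hδ1' : 0 ≤ 1 - δ := by linarith
  have hp1 := heatFlow_pos ht hπ hV.targetDensity_pos
  have hp2 := heatFlow_pos ht hq hq0
  have hpos : ∀ y, 0 < (1 - δ) * heatFlow t (targetDensity V) y + δ * heatFlow t q y := by
    intro y
    have h1 := hp1 y
    have h2 := hp2 y
    -- Either weight of the mixture may vanish, but not both.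
    rcases hδ0.eq_or_lt with rfl | h
    · simpa using h1
    · positivity
  have m1 := measurable_displacement t hπm
  have m2 := measurable_displacement t hqm
  refine (hV.fisherInfo_ofDensity_le (G := fun y => (1 - δ) • heatFlowGradient t (targetDensity V) y
      + δ • heatFlowGradient t q y) hpos (fun y => ?_)
      (((continuous_heatFlowGradient ht hπ).const_smul (1 - δ)).add
      ((continuous_heatFlowGradient ht hq).const_smul δ) :)).trans ?_
  · have h := ((hasGradientAt_iff_innerSL.1 (hasGradientAt_heatFlow ht hπ y)).const_mul
      (1 - δ)).add ((hasGradientAt_iff_innerSL.1 (hasGradientAt_heatFlow ht hq y)).const_mul δ)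
    refine hasGradientAt_iff_innerSL.2 (h.congr_fderiv ?_)
    simp only [map_add, map_smul]
  · calc _ ≤ ∫⁻ y, (ENNReal.ofReal (1 - δ) * displacement t (targetDensity V) y +
          ENNReal.ofReal δ * (2 * (ENNReal.ofReal (t⁻¹ ^ 2) * displacement t q y
          + ENNReal.ofReal (c * (1 + t⁻¹) ^ 2) * displacement t (targetDensity V) y))) := by
          refine lintegral_mono fun y => ENNReal.div_le_of_le_mul' ?_
          have hs : ∀ {s : ℝ} (_ : 0 ≤ s) {v : E d} {r : ℝ} {B : ℝ≥0∞},
              ‖v‖ₑ ^ 2 ≤ ENNReal.ofReal r * B →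
              ‖s • v‖ₑ ^ 2 ≤ ENNReal.ofReal (s * r) * (ENNReal.ofReal s * B) := by
            intro s hs v r B h
            rw [enorm_smul, Real.enorm_eq_ofReal hs, mul_pow, ENNReal.ofReal_mul hs, sq,
              mul_mul_mul_comm]
            gcongr
          -- Joint convexity separates the two components, with weights 1 - δ and δ.
          have h := add_sq_le_add_mul_add
            (hs hδ1' (hV.enorm_heatFlowGradient_add_smul_sq_le ht y))
            (hs hδ0 (hV.enorm_heatFlowGradient_add_smul_sq_le_of_le ht hq hqm
              (fun x => (hq0 x).le) hc0 hqc y))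
          rw [← ENNReal.ofReal_add (mul_nonneg hδ1' (hp1 y).le)
            (mul_nonneg hδ0 (hp2 y).le)] at h
          refine (pow_le_pow_left' (le_trans (le_of_eq ?_) (enorm_add_le _ _)) 2).trans h
          congr 1
          module
      _ = _ := by
          have e1 : ∫⁻ y, displacement t (targetDensity V) y = ENNReal.ofReal (t * d) :=
            lintegral_lintegral_heatKernel_mul ht hπ hπm (fun x => (hV.targetDensity_pos x).le)
              hV.integral_targetDensity
          have e2 : ∫⁻ y, displacement t q y = ENNReal.ofReal (t * d) :=
            lintegral_lintegral_heatKernel_mul ht hq hqm (fun x => (hq0 x).le) hq1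
          rw [lintegral_add_left (by fun_prop), lintegral_const_mul _ m1,
            lintegral_const_mul _ (by fun_prop), lintegral_const_mul _ (by fun_prop),
            lintegral_add_left (by fun_prop), lintegral_const_mul _ m2,
            lintegral_const_mul _ m1, e1, e2]
          have htd : 0 ≤ t * d := by positivity
          rw [ENNReal.ofReal_add (by positivity) (by positivity), ENNReal.ofReal_mul hδ1',
            ENNReal.ofReal_mul hδ0, ENNReal.ofReal_mul zero_le_two,
            ENNReal.ofReal_add (by positivity) (by positivity),
            ENNReal.ofReal_mul (p := t⁻¹ ^ 2) (by positivity),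
            ENNReal.ofReal_mul (p := c * _) (by positivity),
            ENNReal.ofReal_ofNat]

end IsLogSmoothPotential

/-! ### General facts on sampling algorithms -/

namespace SamplingAlgorithm

variable (A : SamplingAlgorithm d) {V f₀ : E d → ℝ}

theorem measurable_step (hV : Measurable V) (hV' : Measurable (gradient V)) (hf : Measurable f₀)
    (k : ℕ) : Measurable (A.step V f₀ k) := by
  have hz : Measurable fun c : (A.State × ℕ) × (A.Seed × E d) =>
      ((c.1.1, c.2) : A.State × A.Seed × E d) := by fun_prop
  have hy := (A.measurable_point k).comp hz
  unfold step
  refine Measurable.ite (((A.measurable_asksLocal k).comp hz) (measurableSet_singleton true)) ?_ ?_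
  · refine Measurable.prodMk ((A.measurable_updateLocal k).comp (hz.prodMk
      ((hf.comp hy).prodMk ((hV.comp hy).prodMk (hV'.comp hy))))) ?_
    exact (measurable_of_countable (fun n : ℕ => n + 1)).comp (by fun_prop)
  · exact Measurable.prodMk ((A.measurable_updateFree k).comp (hz.prodMk (hf.comp hy)))
      (by fun_prop)

theorem isProbabilityMeasure_configLaw (hV : Measurable V) (hV' : Measurable (gradient V))
    (hf : Measurable f₀) [IsProbabilityMeasure (ofDensity f₀)] (k : ℕ) :
    IsProbabilityMeasure (A.configLaw V f₀ k) := by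
  induction k with
  | zero => unfold configLaw; infer_instance
  | succ k ih =>
    unfold configLaw
    exact Measure.isProbabilityMeasure_map (A.measurable_step hV hV' hf k).aemeasurable

/-- The memory never looks at the query counter, so it is a Markov chain by itself and the counter
may be reset to 0. -/
theorem step_fst (k : ℕ) (s : A.State) (n : ℕ) (w : A.Seed × E d) :
    (A.step V f₀ k ((s, n), w)).1 = (A.step V f₀ k ((s, 0), w)).1 := by
  unfold step
  dsimp only
  split_ifs <;> rfl

theorem measurable_lintegral_step (hV : Measurable V) (hV' : Measurable (gradient V))
    (hf : Measurable f₀) [IsProbabilityMeasure (ofDensity f₀)] (k : ℕ) {F : A.State → ℝ≥0∞}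
    (hF : Measurable F) : Measurable fun s =>
      ∫⁻ w, F (A.step V f₀ k ((s, 0), w)).1 ∂(A.seedLaw.prod (ofDensity f₀)) := by
  have hm := A.measurable_step hV hV' hf k
  exact Measurable.lintegral_prod_right' (f := fun p : A.State × A.Seed × E d =>
    F (A.step V f₀ k ((p.1, 0), p.2)).1) (by fun_prop)

theorem lintegral_configLaw_succ (hV : Measurable V) (hV' : Measurable (gradient V))
    (hf : Measurable f₀) [IsProbabilityMeasure (ofDensity f₀)] (k : ℕ) {F : A.State → ℝ≥0∞}
    (hF : Measurable F) :
    ∫⁻ c, F c.1 ∂(A.configLaw V f₀ (k + 1)) =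
      ∫⁻ c, (∫⁻ w, F (A.step V f₀ k ((c.1, 0), w)).1 ∂(A.seedLaw.prod (ofDensity f₀)))
        ∂(A.configLaw V f₀ k) := by
  have := A.isProbabilityMeasure_configLaw hV hV' hf k
  have hm := A.measurable_step hV hV' hf k
  rw [configLaw, lintegral_map (by fun_prop) hm, lintegral_prod _ (by fun_prop)]
  refine lintegral_congr fun c => lintegral_congr fun w => ?_
  rw [← A.step_fst k c.1 c.2 w]

theorem ae_configLaw_succ (hV : Measurable V) (hV' : Measurable (gradient V))
    (hf : Measurable f₀) [IsProbabilityMeasure (ofDensity f₀)] {k n m : ℕ}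
    (h : ∀ᵐ c ∂(A.configLaw V f₀ k), c.2 ≤ n)
    (hstep : ∀ c, c.1.2 ≤ n → (A.step V f₀ k c).2 ≤ m) :
    ∀ᵐ c ∂(A.configLaw V f₀ (k + 1)), c.2 ≤ m := by
  have := A.isProbabilityMeasure_configLaw hV hV' hf k
  rw [configLaw, ae_map_iff (A.measurable_step hV hV' hf k).aemeasurable
    (measurableSet_le measurable_snd measurable_const)]
  filter_upwards [Measure.quasiMeasurePreserving_fst.ae h] with c hc using hstep c hc

theorem ae_configLaw_le (hV : Measurable V) (hV' : Measurable (gradient V))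
    (hf : Measurable f₀) [IsProbabilityMeasure (ofDensity f₀)] (k : ℕ) :
    ∀ᵐ c ∂(A.configLaw V f₀ k), c.2 ≤ k := by
  induction k with
  | zero =>
    rw [configLaw, ae_dirac_iff (measurableSet_le measurable_snd measurable_const)]
  | succ k ih =>
    refine A.ae_configLaw_succ hV hV' hf ih fun c hc => ?_
    unfold step
    dsimp only
    split_ifs <;> simp only <;> omega

end SamplingAlgorithm

/-! ### Consequences of a valid initialization -/

namespace IsValidInit

variable {M₀ : ℝ} {V f₀ : E d → ℝ}

theorem integrable (h : IsValidInit M₀ V f₀) : Integrable f₀ := by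
  have h1 : ∫⁻ x, ENNReal.ofReal (f₀ x) = 1 := by
    simpa [ofDensity] using h.isProbabilityMeasure.measure_univ
  refine ⟨h.measurable.aestronglyMeasurable, ?_⟩
  rw [hasFiniteIntegral_iff_ofReal (.of_forall fun x => (h.pos x).le), h1]
  exact ENNReal.one_lt_top

theorem integral_eq_one (h : IsValidInit M₀ V f₀) : ∫ x, f₀ x = 1 := by
  have h1 : ∫⁻ x, ENNReal.ofReal (f₀ x) = 1 := by
    simpa [ofDensity] using h.isProbabilityMeasure.measure_univ
  rw [integral_eq_lintegral_of_nonneg_ae (.of_forall fun x => (h.pos x).le)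
    h.measurable.aestronglyMeasurable, h1, ENNReal.toReal_one]

theorem init_le (h : IsValidInit M₀ V f₀) {β : ℝ} (hV : IsLogSmoothPotential β V) (x : E d) :
    f₀ x ≤ Real.exp M₀ * targetDensity V x := by
  have hπ := hV.targetDensity_pos x
  rw [← div_le_iff₀ hπ]
  exact (Real.log_le_iff_le_exp (div_pos (h.pos x) hπ)).1 (h.log_init_div_target_le x)

theorem target_le (h : IsValidInit M₀ V f₀) {β : ℝ} (hV : IsLogSmoothPotential β V) (x : E d) :
    targetDensity V x ≤ Real.exp M₀ * f₀ x := by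
  have hπ := hV.targetDensity_pos x
  rw [← div_le_iff₀ (h.pos x)]
  exact (Real.log_le_iff_le_exp (div_pos hπ (h.pos x))).1 (h.log_target_div_init_le x)

end IsValidInit

/-! ### The acceptance probability and the uniform coin. -/

/-- The probability that a trial of the rejection sampler accepts. -/
def acceptProb (M₀ : ℝ) (V f₀ : E d → ℝ) : ℝ :=
  Real.exp (-(2 * M₀)) * (f₀ 0 / targetDensity V 0)

theorem IsLogSmoothPotential.exp_sub_eq {β : ℝ} {V : E d → ℝ} (hV : IsLogSmoothPotential β V)
    (x y : E d) : Real.exp (V y - V x) = targetDensity V x / targetDensity V y := by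
  have := hV.integral_exp_neg_pos
  unfold targetDensity
  rw [div_div_div_cancel_right₀ this.ne', ← Real.exp_sub]
  ring_nf

theorem volume_unitInterval_mul_le {b e : ℝ} (hb : 0 < b) (he : 0 ≤ e) (heb : e ≤ b) :
    (volume : Measure unitInterval) {u | (u : ℝ) * b ≤ e} = ENNReal.ofReal (e / b) := by
  have h : {u : unitInterval | (u : ℝ) * b ≤ e}
      = Set.Iic ⟨e / b, by positivity, (div_le_one hb).2 heb⟩ := by
    ext u
    simp [← Subtype.coe_le_coe, le_div_iff₀ hb]
  rw [h, unitInterval.volume_Iic]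

theorem lintegral_unitInterval_ite {b e : ℝ} (hb : 0 < b) (he : 0 ≤ e) (heb : e ≤ b)
    (p q : ℝ≥0∞) :
    ∫⁻ u : unitInterval, (if (u : ℝ) * b ≤ e then p else q) =
      ENNReal.ofReal (e / b) * p + ENNReal.ofReal (1 - e / b) * q := by
  have hm : MeasurableSet {u : unitInterval | (u : ℝ) * b ≤ e} :=
    measurableSet_le (by fun_prop) measurable_const
  have h := volume_unitInterval_mul_le hb he heb
  have hc : (volume : Measure unitInterval) {u | (u : ℝ) * b ≤ e}ᶜ
      = ENNReal.ofReal (1 - e / b) := by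
    rw [prob_compl_eq_one_sub hm, h, ENNReal.ofReal_sub _ (by positivity), ENNReal.ofReal_one]
  let f : unitInterval → ℝ≥0∞ := fun u => if (u : ℝ) * b ≤ e then p else q
  rw [← lintegral_add_compl f hm, setLIntegral_congr_fun (f := f) (g := fun _ => p) hm
    fun u hu => if_pos hu, setLIntegral_congr_fun (f := f) (g := fun _ => q) hm.compl
    fun u hu => if_neg hu, setLIntegral_const, setLIntegral_const, h, hc, mul_comm, mul_comm q]

/-! ### The law of the rejection sampler -/

namespace IsValidInit

variable {M₀ : ℝ} {V f₀ : E d → ℝ}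

theorem acceptProb_le_one (h : IsValidInit M₀ V f₀) {β : ℝ} (hV : IsLogSmoothPotential β V)
    (hM : 0 ≤ M₀) : acceptProb M₀ V f₀ ≤ 1 := by
  have hπ := hV.targetDensity_pos 0
  have h1 : f₀ 0 / targetDensity V 0 ≤ Real.exp M₀ := (div_le_iff₀ hπ).2 (h.init_le hV 0)
  calc acceptProb M₀ V f₀ ≤ Real.exp (-(2 * M₀)) * Real.exp M₀ := by
        unfold acceptProb; gcongr
    _ = Real.exp (-M₀) := by rw [← Real.exp_add]; ring_nf
    _ ≤ 1 := Real.exp_le_one_iff.2 (by linarith)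

/-- The source of e^{3M₀}: the envelope constant contributes e^{-2M₀}, and comparing μ₀ with π at
the origin loses another e^{-M₀}. -/
theorem le_acceptProb (h : IsValidInit M₀ V f₀) {β : ℝ} (hV : IsLogSmoothPotential β V) :
    Real.exp (-(3 * M₀)) ≤ acceptProb M₀ V f₀ := by
  have hπ := hV.targetDensity_pos 0
  have h1 : Real.exp (-M₀) ≤ f₀ 0 / targetDensity V 0 := by
    rw [le_div_iff₀ hπ, Real.exp_neg, inv_mul_le_iff₀ (Real.exp_pos _)]
    exact h.target_le hV 0
  calc Real.exp (-(3 * M₀)) = Real.exp (-(2 * M₀)) * Real.exp (-M₀) := by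
        rw [← Real.exp_add]; ring_nf
    _ ≤ _ := by unfold acceptProb; gcongr

/-- Proposal density times acceptance probability is aπ, so the accepted point is distributed
exactly as π, although the normalizing constant is unknown. -/
theorem lintegral_trial (h : IsValidInit M₀ V f₀) {β : ℝ} (hV : IsLogSmoothPotential β V)
    (hM : 0 ≤ M₀) {F : E d → ℝ≥0∞} (hF : Measurable F) (q : ℝ≥0∞) :
    ∫⁻ x, (∫⁻ u : unitInterval, if (u : ℝ) * (Real.exp (2 * M₀) / f₀ 0 * f₀ x) ≤
        Real.exp (V 0 - V x) then F x else q) ∂(ofDensity f₀) =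
      ENNReal.ofReal (acceptProb M₀ V f₀) * ∫⁻ x, F x ∂(target V) +
        ENNReal.ofReal (1 - acceptProb M₀ V f₀) * q := by
  have hf := h.measurable
  have hcV := hV.continuous.measurable
  have hcπ := hV.continuous_targetDensity.measurable
  have hf0 := h.pos 0
  have hπ0 := hV.targetDensity_pos 0
  have ha0 : 0 ≤ acceptProb M₀ V f₀ := (Real.exp_pos _).le.trans (h.le_acceptProb hV)
  have ha1 := h.acceptProb_le_one hV hM
  set a := acceptProb M₀ V f₀ with ha
  have hratio : ∀ x, f₀ x * (Real.exp (V 0 - V x) / (Real.exp (2 * M₀) / f₀ 0 * f₀ x))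
      = a * targetDensity V x := fun x => by
    have := (h.pos x).ne'
    rw [hV.exp_sub_eq, ha, acceptProb, Real.exp_neg]
    field_simp
  -- The acceptance ratio is at most 1: one e^{M₀} bounds π/μ₀ at x, the other bounds μ₀/π at 0.
  have hle : ∀ x, Real.exp (V 0 - V x) ≤ Real.exp (2 * M₀) / f₀ 0 * f₀ x := fun x => by
    rw [hV.exp_sub_eq, div_le_iff₀ hπ0, two_mul, Real.exp_add]
    calc targetDensity V x ≤ Real.exp M₀ * f₀ x := h.target_le hV x
      _ = Real.exp M₀ * f₀ x / f₀ 0 * f₀ 0 := by field_simp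
      _ ≤ Real.exp M₀ * f₀ x / f₀ 0 * (Real.exp M₀ * targetDensity V 0) := by
        have := h.pos x
        gcongr
        exact h.init_le hV 0
      _ = _ := by ring
  have hb : ∀ x, 0 < Real.exp (2 * M₀) / f₀ 0 * f₀ x := fun x => by
    have := h.pos x
    positivity
  simp_rw [fun x => lintegral_unitInterval_ite (hb x) (Real.exp_pos _).le (hle x) (F x) q]
  rw [lintegral_ofDensity hf (by fun_prop)]
  have hint : ∀ x, ENNReal.ofReal (f₀ x) * (ENNReal.ofReal
        (Real.exp (V 0 - V x) / (Real.exp (2 * M₀) / f₀ 0 * f₀ x)) * F x +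
        ENNReal.ofReal (1 - Real.exp (V 0 - V x) / (Real.exp (2 * M₀) / f₀ 0 * f₀ x)) * q)
      = ENNReal.ofReal a * (ENNReal.ofReal (targetDensity V x) * F x) +
        ENNReal.ofReal (f₀ x - a * targetDensity V x) * q := fun x => by
    rw [mul_add, ← mul_assoc, ← mul_assoc, ← ENNReal.ofReal_mul (h.pos x).le, hratio,
      ← ENNReal.ofReal_mul (h.pos x).le, mul_one_sub, hratio, ENNReal.ofReal_mul ha0, mul_assoc]
  simp_rw [hint]
  have hsub : Integrable fun x => f₀ x - a * targetDensity V x :=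
    h.integrable.sub (hV.integrable_targetDensity.const_mul a)
  rw [lintegral_add_left (by fun_prop), lintegral_const_mul _ (by fun_prop), target,
    lintegral_ofDensity hcπ hF, lintegral_mul_const _ (by fun_prop),
    ← ofReal_integral_eq_lintegral_ofReal hsub (.of_forall fun x => ?_)]
  · rw [integral_sub h.integrable (hV.integrable_targetDensity.const_mul a),
      integral_const_mul, h.integral_eq_one, hV.integral_targetDensity, mul_one]
  · have h1 := (div_le_one (hb x)).2 (hle x)
    have h2 := hratio x
    have := h.pos x
    simp only [Pi.zero_apply, ← h2]
    nlinarith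

end IsValidInit

/-- There are N + 2 steps, but the last one only adds noise and makes no query. -/
theorem rejectionSampler_ae_le {M₀ t : ℝ} {N : ℕ} {V f₀ : E d → ℝ} (hV : Measurable V)
    (hV' : Measurable (gradient V)) (hf : Measurable f₀) [IsProbabilityMeasure (ofDensity f₀)] :
    ∀ᵐ c ∂((rejectionSampler d M₀ N t).configLaw V f₀ (rejectionSampler d M₀ N t).steps),
      c.2 ≤ N + 1 := by
  refine SamplingAlgorithm.ae_configLaw_succ (k := N + 1) _ hV hV' hf
    (SamplingAlgorithm.ae_configLaw_le _ hV hV' hf _) fun c hc => ?_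
  have : ¬ (rejectionSampler d M₀ N t).asksLocal (N + 1) (c.1.1, c.2) = true := by
    simp [rejectionSampler]
  rw [SamplingAlgorithm.step]
  simp only [this]
  exact hc

/-- The law of the memory of the rejection sampler after `k` trials. -/
theorem lintegral_configLaw_rejectionSampler {M₀ t β : ℝ} {N : ℕ} {V f₀ : E d → ℝ}
    (hV : IsLogSmoothPotential β V) (h : IsValidInit M₀ V f₀) (hM : 0 ≤ M₀) {k : ℕ}
    (hk : k ≤ N) {F : (ℝ × ℝ) × Bool × E d → ℝ≥0∞} (hF : Measurable F) :
    ∫⁻ c, F c.1 ∂((rejectionSampler d M₀ N t).configLaw V f₀ (k + 1)) =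
      ENNReal.ofReal (1 - (1 - acceptProb M₀ V f₀) ^ k)
          * ∫⁻ x, F ((V 0, f₀ 0), true, x) ∂(target V)
        + ENNReal.ofReal ((1 - acceptProb M₀ V f₀) ^ k) * F ((V 0, f₀ 0), false, 0) := by
  have := h.isProbabilityMeasure
  have hVm := hV.continuous.measurable
  have hVm' := hV.continuous_gradient.measurable
  have hf := h.measurable
  have ha0 : 0 ≤ acceptProb M₀ V f₀ := (Real.exp_pos _).le.trans (h.le_acceptProb hV)
  have ha1 := h.acceptProb_le_one hV hM
  set A := rejectionSampler d M₀ N t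
  set a := acceptProb M₀ V f₀
  have := A.isProbabilityMeasure_seedLaw
  -- Step `0` queries the origin, so `k` trials amount to `k + 1` steps. `F` must vary, because the
  -- inductive hypothesis is applied to its one-step average.
  induction k generalizing F with
  | zero =>
    have hmF : Measurable fun c : A.State × ℕ => ∫⁻ w, F (A.step V f₀ 0 ((c.1, 0), w)).1
        ∂(A.seedLaw.prod (ofDensity f₀)) :=
      (A.measurable_lintegral_step hVm hVm' hf 0 hF).comp measurable_fst
    rw [A.lintegral_configLaw_succ hVm hVm' hf 0 hF, SamplingAlgorithm.configLaw,
      lintegral_dirac' _ hmF]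
    have hs : ∀ w, (A.step V f₀ 0 ((A.start, 0), w)).1 = ((V 0, f₀ 0), false, 0) := fun w => by
      simp [SamplingAlgorithm.step, A, rejectionSampler]
    simp only [hs]
    simp
  | succ k ih =>
    have hmF : Measurable fun s => ∫⁻ w, F (A.step V f₀ (k + 1) ((s, 0), w)).1
        ∂(A.seedLaw.prod (ofDensity f₀)) :=
      A.measurable_lintegral_step hVm hVm' hf (k + 1) hF
    rw [A.lintegral_configLaw_succ hVm hVm' hf (k + 1) hF, ih (by omega) hmF]
    have h1 : ∀ x w, (A.step V f₀ (k + 1) ((((V 0, f₀ 0), true, x), 0), w)).1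
        = ((V 0, f₀ 0), true, x) := fun x w => by
      -- Step `k + 1` is not the smoothing step, so an accepted point stays frozen.
      have : ¬ k = N := by omega
      simp [SamplingAlgorithm.step, A, rejectionSampler, this]
    have h2 : ∀ w : (unitInterval × E d) × E d,
        (A.step V f₀ (k + 1) ((((V 0, f₀ 0), false, 0), 0), w)).1
        = if (w.1.1 : ℝ) * (Real.exp (2 * M₀) / f₀ 0 * f₀ w.2) ≤ Real.exp (V 0 - V w.2) then
            ((V 0, f₀ 0), true, w.2) else ((V 0, f₀ 0), false, 0) := fun w => by
      simp [SamplingAlgorithm.step, A, rejectionSampler, hk]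
    have hs : MeasurableSet {w : (unitInterval × E d) × E d |
        (w.1.1 : ℝ) * (Real.exp (2 * M₀) / f₀ 0 * f₀ w.2) ≤ Real.exp (V 0 - V w.2)} :=
      measurableSet_le (by fun_prop) (by fun_prop)
    have hite : Measurable fun w : (unitInterval × E d) × E d =>
        if (w.1.1 : ℝ) * (Real.exp (2 * M₀) / f₀ 0 * f₀ w.2) ≤ Real.exp (V 0 - V w.2) then
          F ((V 0, f₀ 0), true, w.2) else F ((V 0, f₀ 0), false, 0) :=
      Measurable.ite hs (by fun_prop) measurable_const
    have h3 : ∫⁻ w, F (A.step V f₀ (k + 1) ((((V 0, f₀ 0), false, 0), 0), w)).1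
        ∂(A.seedLaw.prod (ofDensity f₀)) =
        ENNReal.ofReal a * ∫⁻ x, F ((V 0, f₀ 0), true, x) ∂(target V)
          + ENNReal.ofReal (1 - a) * F ((V 0, f₀ 0), false, 0) := by
      rw [← h.lintegral_trial hV hM (by fun_prop)]
      calc _ = ∫⁻ w, (if (w.1.1 : ℝ) * (Real.exp (2 * M₀) / f₀ 0 * f₀ w.2) ≤
                Real.exp (V 0 - V w.2) then F ((V 0, f₀ 0), true, w.2)
                else F ((V 0, f₀ 0), false, 0))
              ∂(((volume : Measure unitInterval).prod (stdGaussian (E d))).prod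
                (ofDensity f₀)) := by
            refine lintegral_congr fun w => ?_
            exact (congrArg F (h2 w)).trans (apply_ite F _ _ _)
        _ = _ := by
            rw [lintegral_prod_symm' _ hite]
            refine lintegral_congr fun x => ?_
            refine (lintegral_prod _
              (hite.comp (measurable_prodMk_right (y := x))).aemeasurable).trans ?_
            refine lintegral_congr fun u => ?_
            by_cases hu : (u : ℝ) * (Real.exp (2 * M₀) / f₀ 0 * f₀ x) ≤ Real.exp (V 0 - V x) <;>
              simp [hu]
    have h4 : ∀ x, ∫⁻ w, F (A.step V f₀ (k + 1) ((((V 0, f₀ 0), true, x), 0), w)).1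
        ∂(A.seedLaw.prod (ofDensity f₀)) = F ((V 0, f₀ 0), true, x) := fun x => by
      simp only [h1, lintegral_const, measure_univ, mul_one]
    have hak : 0 ≤ (1 - a) ^ k := pow_nonneg (by linarith) k
    have hak1 : (1 - a) ^ k ≤ 1 := pow_le_one₀ (by linarith) (by linarith)
    -- The weight of π updates by (1 - (1 - a)^k) + (1 - a)^k a = 1 - (1 - a)^(k+1).
    rw [lintegral_congr h4, h3, mul_add, ← mul_assoc, ← mul_assoc, ← add_assoc, ← add_mul,
      ← ENNReal.ofReal_mul hak, ← ENNReal.ofReal_mul hak,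
      ← ENNReal.ofReal_add (by linarith) (mul_nonneg hak ha0)]
    ring_nf

theorem lintegral_add_sqrt_smul_stdGaussian {t : ℝ} (ht : 0 < t) {q : E d → ℝ}
    (hq : Integrable q) (hqm : Measurable q) (hq0 : ∀ x, 0 ≤ q x) {G : E d → ℝ≥0∞}
    (hG : Measurable G) :
    ∫⁻ x, (∫⁻ z, G (x + √t • z) ∂(stdGaussian (E d))) ∂(ofDensity q) =
      ∫⁻ y, ENNReal.ofReal (heatFlow t q y) * G y := by
  have hcont := continuous_heatKernel (d := d) t
  have h1 : ∀ x : E d, ∫⁻ z, G (x + √t • z) ∂(stdGaussian (E d)) =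
      ∫⁻ y, ENNReal.ofReal (heatKernel t (y - x)) * G y := fun x => by
    rw [← lintegral_map (f := fun z => G (x + z)) (g := fun z => √t • z) (by fun_prop)
      (by fun_prop), map_sqrt_smul_stdGaussian ht,
      lintegral_ofDensity hcont.measurable (by fun_prop),
      ← lintegral_sub_right_eq_self (fun z => ENNReal.ofReal (heatKernel t z) * G (x + z)) x]
    simp
  simp_rw [h1]
  rw [lintegral_ofDensity hqm (Measurable.lintegral_prod_right' (f := fun p : E d × E d =>
    ENNReal.ofReal (heatKernel t (p.2 - p.1)) * G p.2) (by fun_prop))]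
  rw [lintegral_congr fun x => (lintegral_const_mul (ENNReal.ofReal (q x))
    (by fun_prop : Measurable fun y => ENNReal.ofReal (heatKernel t (y - x)) * G y)).symm,
    lintegral_lintegral_swap (by fun_prop)]
  refine lintegral_congr fun y => ?_
  rw [ofReal_heatFlow ht hq hq0, ← lintegral_mul_const _ (by fun_prop)]
  simp_rw [ENNReal.ofReal_mul (hq0 _), mul_assoc]

/-- The fresh sample used after N failures makes the law an exact mixture with known components,
rather than merely close to π_t. -/
theorem outputLaw_rejectionSampler {M₀ t β : ℝ} {N : ℕ} {V f₀ : E d → ℝ} (ht : 0 < t)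
    (hV : IsLogSmoothPotential β V) (h : IsValidInit M₀ V f₀) (hM : 0 ≤ M₀) :
    (rejectionSampler d M₀ N t).outputLaw V f₀ =
      ofDensity fun y => (1 - (1 - acceptProb M₀ V f₀) ^ N) * heatFlow t (targetDensity V) y
        + (1 - acceptProb M₀ V f₀) ^ N * heatFlow t f₀ y := by
  have := h.isProbabilityMeasure
  have hVm := hV.continuous.measurable
  have hVm' := hV.continuous_gradient.measurable
  have hf := h.measurable
  have hπ := hV.integrable_targetDensity
  have hπm := hV.continuous_targetDensity.measurable
  have hπ0 := fun x => (hV.targetDensity_pos x).le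
  have hf0 := fun x => (h.pos x).le
  have ha0 : 0 ≤ acceptProb M₀ V f₀ := (Real.exp_pos _).le.trans (h.le_acceptProb hV)
  have ha1 := h.acceptProb_le_one hV hM
  have hcπ : Continuous (heatFlow t (targetDensity V)) :=
    continuous_iff_continuousAt.2 fun x => (hasGradientAt_heatFlow ht hπ x).continuousAt
  have hcf : Continuous (heatFlow t f₀) :=
    continuous_iff_continuousAt.2 fun x => (hasGradientAt_heatFlow ht h.integrable x).continuousAt
  have hp1 := fun y => (heatFlow_pos ht hπ hV.targetDensity_pos y).le
  have hp2 := fun y => (heatFlow_pos ht h.integrable h.pos y).le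
  set A := rejectionSampler d M₀ N t
  set a := acceptProb M₀ V f₀
  have := A.isProbabilityMeasure_seedLaw
  have hak : 0 ≤ (1 - a) ^ N := pow_nonneg (by linarith) N
  have hak1 : 0 ≤ 1 - (1 - a) ^ N := sub_nonneg.2 (pow_le_one₀ (by linarith) (by linarith))
  refine Measure.ext_of_lintegral _ fun G hG => ?_
  have hF : Measurable fun s : (ℝ × ℝ) × Bool × E d => G s.2.2 := by fun_prop
  have hmain : ∫⁻ y, G y ∂(A.outputLaw V f₀) =
      ∫⁻ c, G c.1.2.2 ∂(A.configLaw V f₀ (N + 1 + 1)) :=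
    lintegral_map hG (A.measurable_output.comp measurable_fst)
  have h1 : ∀ x, ∫⁻ w, G (A.step V f₀ (N + 1) ((((V 0, f₀ 0), true, x), 0), w)).1.2.2
      ∂(A.seedLaw.prod (ofDensity f₀)) = ∫⁻ z, G (x + √t • z) ∂(stdGaussian (E d)) := fun x => by
    calc _ = ∫⁻ w, G (x + √t • w.1.2) ∂(((volume : Measure unitInterval).prod
              (stdGaussian (E d))).prod (ofDensity f₀)) := by
          refine lintegral_congr fun w => ?_
          simp [SamplingAlgorithm.step, A, rejectionSampler]
      _ = _ := by
          rw [lintegral_prod _ (by fun_prop)]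
          simp only [lintegral_const, measure_univ, mul_one]
          rw [lintegral_prod _ (by fun_prop)]
          simp only [lintegral_const, measure_univ, mul_one]
  have h2 : ∫⁻ w, G (A.step V f₀ (N + 1) ((((V 0, f₀ 0), false, 0), 0), w)).1.2.2
      ∂(A.seedLaw.prod (ofDensity f₀)) =
      ∫⁻ x, (∫⁻ z, G (x + √t • z) ∂(stdGaussian (E d))) ∂(ofDensity f₀) := by
    calc _ = ∫⁻ w, G (w.2 + √t • w.1.2) ∂(((volume : Measure unitInterval).prod
              (stdGaussian (E d))).prod (ofDensity f₀)) := by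
          refine lintegral_congr fun w => ?_
          simp [SamplingAlgorithm.step, A, rejectionSampler]
      _ = _ := by
          rw [lintegral_prod_symm' _ (by fun_prop)]
          refine lintegral_congr fun x => ?_
          rw [lintegral_prod _ (by fun_prop)]
          simp only [lintegral_const, measure_univ, mul_one]
  rw [hmain, A.lintegral_configLaw_succ hVm hVm' hf (N + 1) hF,
    lintegral_configLaw_rejectionSampler hV h hM le_rfl
      (A.measurable_lintegral_step hVm hVm' hf (N + 1) hF), lintegral_congr h1, h2, target,
    lintegral_add_sqrt_smul_stdGaussian ht hπ hπm hπ0 hG,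
    lintegral_add_sqrt_smul_stdGaussian ht h.integrable hf hf0 hG,
    ← lintegral_const_mul _ (by fun_prop), ← lintegral_const_mul _ (by fun_prop),
    ← lintegral_add_left (by fun_prop), lintegral_ofDensity (by fun_prop) hG]
  refine lintegral_congr fun y => ?_
  rw [ENNReal.ofReal_add (mul_nonneg hak1 (hp1 y)) (mul_nonneg hak (hp2 y)),
    ENNReal.ofReal_mul hak1, ENNReal.ofReal_mul hak, add_mul, mul_assoc, mul_assoc]

/-! ### Choice of the parameters -/

theorem one_sub_acceptProb_pow_le {M₀ β B : ℝ} {V f₀ : E d → ℝ} (hV : IsLogSmoothPotential β V)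
    (h : IsValidInit M₀ V f₀) (hM : 0 ≤ M₀) {N : ℕ} (hN : Real.exp (3 * M₀) * B ≤ N) :
    (1 - acceptProb M₀ V f₀) ^ N ≤ Real.exp (-B) := by
  have ha := h.le_acceptProb hV
  have ha1 := h.acceptProb_le_one hV hM
  refine (pow_le_pow_left₀ (by linarith) (Real.one_sub_le_exp_neg _) N).trans ?_
  rw [← Real.exp_nat_mul, Real.exp_le_exp, mul_neg, neg_le_neg_iff]
  calc B = Real.exp (3 * M₀) * B * Real.exp (-(3 * M₀)) := by
        rw [mul_right_comm, ← Real.exp_add]; simp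
    _ ≤ N * acceptProb M₀ V f₀ := by gcongr

/-- The choice of t gives td = ε²/2, half of the budget. With R² = d/ε² one has t⁻¹ = 2R², so the
other cost is of order e^{M₀} max(1, R⁴) ε². The exponent M₀ + 4L cancels e^{M₀} and R⁴, and the
final 4 absorbs numerical constants. -/
theorem fisherInfo_constant_le {ε M₀ L δ t : ℝ} (hd : 1 ≤ d) (hε : 0 < ε) (hM : 0 ≤ M₀)
    (hL : L = max 1 (Real.log (√(d : ℝ) / ε))) (ht : t = ε ^ 2 / (2 * d)) (hδ0 : 0 ≤ δ)
    (hδ : δ ≤ Real.exp (-(M₀ + 4 * L + 4))) :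
    (1 - δ) * (t * d) + δ * (2 * (t⁻¹ ^ 2 * (t * d) + Real.exp M₀ * (1 + t⁻¹) ^ 2 * (t * d)))
      ≤ ε ^ 2 := by
  have hd0 : (0 : ℝ) < d := by exact_mod_cast hd
  set R := √(d : ℝ) / ε with hR
  have hR0 : 0 < R := by positivity
  have hR2 : R ^ 2 = d / ε ^ 2 := by rw [hR, div_pow, Real.sq_sqrt hd0.le]
  have htd : t * d = ε ^ 2 / 2 := by rw [ht]; field_simp
  have hti : t⁻¹ = 2 * R ^ 2 := by rw [ht, hR2]; field_simp
  set S := Real.exp (4 * L) with hS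
  have hRL : R ≤ Real.exp L := by
    rw [← Real.log_le_iff_le_exp hR0, hL]; exact le_max_right _ _
  have hL1 : 1 ≤ L := hL ▸ le_max_left _ _
  have hS4 : R ^ 4 ≤ S := by
    rw [hS, show 4 * L = ((4 : ℕ) : ℝ) * L by norm_num, Real.exp_nat_mul]
    gcongr
  have hS1 : 1 ≤ S := Real.one_le_exp (by linarith)
  have hS2 : R ^ 2 ≤ S := by nlinarith [sq_nonneg (R ^ 2 - 1)]
  have hc1 : 1 ≤ Real.exp M₀ := Real.one_le_exp hM
  set c := Real.exp M₀
  -- 26 = 2 · 13, where 13 = 4 + 9 comes from the two squares estimated in `h1`.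
  have he4 : (26 : ℝ) ≤ Real.exp 4 := by
    have h1 := Real.exp_one_gt_d9
    rw [show (4 : ℝ) = ((4 : ℕ) : ℝ) * 1 by norm_num, Real.exp_nat_mul]
    calc (26 : ℝ) ≤ 2.7 ^ 4 := by norm_num
      _ ≤ _ := by gcongr; linarith
  have hδ' : δ * (c * S) * 26 ≤ 1 := by
    calc δ * (c * S) * 26 ≤ Real.exp (-(M₀ + 4 * L + 4)) * (c * S) * Real.exp 4 := by gcongr
      _ = 1 := by
        rw [hS, ← Real.exp_add, ← Real.exp_add, ← Real.exp_add]
        ring_nf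
        exact Real.exp_zero
  have hε2 : 0 < ε ^ 2 := by positivity
  rw [htd, hti]
  have h1 : (2 * R ^ 2) ^ 2 + c * (1 + 2 * R ^ 2) ^ 2 ≤ 13 * (c * S) := by
    have e1 : (2 * R ^ 2) ^ 2 ≤ 4 * (c * S) := by nlinarith
    have e2 : (1 + 2 * R ^ 2) ^ 2 ≤ 9 * S := by nlinarith
    nlinarith
  have h2 : δ * ((2 * R ^ 2) ^ 2 + c * (1 + 2 * R ^ 2) ^ 2) ≤ 1 / 2 := by
    calc _ ≤ δ * (13 * (c * S)) := by gcongr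
      _ ≤ 1 / 2 := by linarith
  nlinarith [mul_le_mul_of_nonneg_right h2 hε2.le, mul_nonneg hδ0 hε2.le]

/-- X ≥ e^{3M₀} gives M₀ ≤ log X, which is why one logarithmic factor suffices. The constant is 10 =
8 + 2: 8 from M₀ + 4L + 4 ≤ L(M₀ + 8), and 2 from rounding up and the query at the origin. -/
theorem trial_number_le {M₀ L X : ℝ} (hM : 0 ≤ M₀) (hL : 1 ≤ L) (hX : X = Real.exp (3 * M₀) * L) :
    ((⌈Real.exp (3 * M₀) * (M₀ + 4 * L + 4)⌉₊ + 1 : ℕ) : ℝ) ≤ 10 * X * (1 + Real.log X) ^ 1 := by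
  have h1 := (Nat.ceil_lt_add_one
    (show 0 ≤ Real.exp (3 * M₀) * (M₀ + 4 * L + 4) by positivity)).le
  have hexp : 1 ≤ Real.exp (3 * M₀) := Real.one_le_exp (by linarith)
  have hlog : M₀ ≤ Real.log X := by
    rw [hX, Real.log_mul (by positivity) (by positivity), Real.log_exp]
    linarith [Real.log_nonneg hL]
  have hX1 : 1 ≤ X := hX ▸ one_le_mul_of_one_le_of_one_le hexp hL
  have h2 : Real.exp (3 * M₀) * (M₀ + 4 * L + 4) ≤ X * (M₀ + 8) := by
    rw [hX, mul_assoc]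
    gcongr
    nlinarith
  push_cast
  nlinarith

theorem rejectionSampler_achieves {ε M₀ L t : ℝ} (hd : 1 ≤ d) (hε : 0 < ε) (hM : 0 ≤ M₀)
    (hL : L = max 1 (Real.log (√(d : ℝ) / ε))) (ht : t = ε ^ 2 / (2 * d)) {N : ℕ}
    (hN : Real.exp (3 * M₀) * (M₀ + 4 * L + 4) ≤ N) :
    (rejectionSampler d M₀ N t).Achieves M₀ ε (N + 1) := by
  intro V f₀ hV h
  have := h.isProbabilityMeasure
  have hd0 : (0 : ℝ) < d := by exact_mod_cast hd
  have ht0 : 0 < t := by rw [ht]; positivity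
  have ha0 : 0 ≤ acceptProb M₀ V f₀ := (Real.exp_pos _).le.trans (h.le_acceptProb hV)
  have ha1 := h.acceptProb_le_one hV hM
  refine ⟨rejectionSampler_ae_le hV.continuous.measurable hV.continuous_gradient.measurable
    h.measurable, ?_⟩
  have hδ0 : 0 ≤ (1 - acceptProb M₀ V f₀) ^ N := pow_nonneg (by linarith) N
  have hδ1 : (1 - acceptProb M₀ V f₀) ^ N ≤ 1 := pow_le_one₀ (by linarith) (by linarith)
  have hFI : fisherInfo ((rejectionSampler d M₀ N t).outputLaw V f₀) (target V)
      ≤ ENNReal.ofReal (ε ^ 2) := by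
    rw [outputLaw_rejectionSampler ht0 hV h hM]
    exact (hV.fisherInfo_heatFlow_mixture_le ht0 h.integrable h.measurable h.pos
      h.integral_eq_one (Real.exp_pos M₀).le (h.init_le hV) hδ0 hδ1).trans
      (ENNReal.ofReal_le_ofReal (fisherInfo_constant_le hd hε hM hL ht hδ0
        (one_sub_acceptProb_pow_le hV h hM hN)))
  refine (ENNReal.rpow_le_rpow hFI (by norm_num)).trans_eq ?_
  rw [ENNReal.ofReal_rpow_of_nonneg (by positivity) (by norm_num), ← Real.sqrt_eq_rpow,
    Real.sqrt_sq hε.le]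

theorem queryComplexity_le {M₀ ε : ℝ} {n : ℕ} {A : SamplingAlgorithm d}
    (hA : A.Achieves M₀ ε n) : queryComplexity d M₀ ε ≤ n :=
  iInf₂_le n ⟨A, hA⟩

end FisherSampling

end

/-! ### The proposition. -/

theorem propositionD1 :
    ∃ C : ℝ, 0 < C ∧ ∃ k : ℕ, ∀ (d : ℕ), 1 ≤ d → ∀ M₀ ε : ℝ, 0 ≤ M₀ → 0 < ε →
      ∀ X : ℝ, X = Real.exp (3 * M₀) * max 1 (Real.log (√(d : ℝ) / ε)) →
        (∃ (N : ℕ) (t : ℝ), 0 < t ∧ t ≤ ε ^ 2 / d ∧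
          ((N + 1 : ℕ) : ℝ) ≤ C * X * (1 + Real.log X) ^ k ∧
          (FisherSampling.rejectionSampler d M₀ N t).Achieves M₀ ε (N + 1)) ∧
        ((FisherSampling.queryComplexity d M₀ ε : ENat) : ENNReal) ≤
          ENNReal.ofReal (C * X * (1 + Real.log X) ^ k) := by
  refine ⟨10, by norm_num, 1, fun d hd M₀ ε hM hε X hX => ?_⟩
  have hd0 : (0 : ℝ) < d := by exact_mod_cast hd
  have hN := FisherSampling.trial_number_le hM (le_max_left _ _) hX
  have hA := FisherSampling.rejectionSampler_achieves hd hε hM rfl rfl (Nat.le_ceil _)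
  refine ⟨⟨_, ε ^ 2 / (2 * d), by positivity, ?_, hN, hA⟩, ?_⟩
  · gcongr
    linarith
  · refine (ENat.toENNReal_le.2 (FisherSampling.queryComplexity_le hA)).trans ?_
    rw [ENat.toENNReal_coe, ← ENNReal.ofReal_natCast]
    exact ENNReal.ofReal_le_ofReal hN
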